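/- Let $k$ be a field and let $\Lambda$ be a finite-dimensional $k$-algebra. Write $\operatorname{mod}\Lambda$ for the category of finitely generated left $\Lambda$-modules, and let $$\mathcal U=\mathcal U(\Lambda)=\operatorname{add}\{A[i]\mid A\in\operatorname{mod}\Lambda,\ i\in\mathbb Z\}$$ be its Yoneda category, i.e. the full subcategory of the bounded derived category $D^b(\operatorname{mod}\Lambda)$ consisting of the direct summands of finite direct sums of shifts of modules. For a preadditive category $\mathcal C$, let $\operatorname{mod}\mathcal C$ be the category of finitely presented $\mathcal C$-modules, i.e. of the contravariant additive functors $X$ from $\mathcal C$ to abelian groups that admit an exact sequence $\mathcal C(-,B)\to\mathcal C(-,A)\to X\to 0$ with $A,B\in\mathcal C$. (1) The category $\mathcal U$ is coherent (it has weak kernels and weak cokernels), the categories $\operatorname{mod}\mathcal U$ and $\operatorname{mod}\mathcal U^{\mathrm{op}}$ are abelian, and for every $A\in\mathcal U$ the representable module $\mathcal U(-,A)$ has injective dimension at most $1$ in $\operatorname{mod}\mathcal U$ and $\mathcal U(A,-)$ has injective dimension at most $1$ in $\operatorname{mod}\mathcal U^{\mathrm{op}}$. That is, $\mathcal U$ is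 $1$-Gorenstein. (2) Suppose that $\Lambda$ is of finite representation type and that $M$ is an additive generator of $\operatorname{mod}\Lambda$, i.e. every finitely generated $\Lambda$-module is a direct summand of $M^n$ for some $n$. Let $\Gamma=\bigoplus_{i\ge 0}\operatorname{Ext}^i_\Lambda(M,M)$ be the Yoneda algebra, a $\mathbb Z$-graded ring under the Yoneda product. Then $\Gamma$ is graded coherent and graded $1$-Gorenstein: the categories of finitely presented $\mathbb Z$-graded left $\Gamma$-modules and of finitely presented $\mathbb Z$-graded right $\Gamma$-modules (with the morphisms of degree $0$) are abelian, and $\Gamma$ has injective dimension at most $1$ in each of them. -/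

import Mathlib

open CategoryTheory CategoryTheory.Limits
open scoped DirectSum

universe w' w v u

noncomputable section

/-! ### Additive closures -/

section AddClosure

variable {C : Type u} [Category.{v} C] [Preadditive C] [HasFiniteBiproducts C]

/-- `add P`: the direct summands of finite direct sums of objects satisfying `P`. -/
def addClosure (P : ObjectProperty C) : ObjectProperty C := fun X =>
  ∃ (n : ℕ) (F : Fin n → C), (∀ j, P (F j)) ∧ Nonempty (Retract X (⨁ F))

/-- `M` is an additive generator of `C`: `add M = C`. -/
def IsAdditiveGenerator (M : C) : Prop :=
  ∀ X : C, addClosure (fun Y => Y = M) X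

end AddClosure

/-! ### Modules over a preadditive category -/

section ModulesOverCategories

variable (C : Type u) [Category.{v} C] [Preadditive C]

/-- A `C`-module is a contravariant additive functor from `C` to abelian groups. It is finitely
presented if there is an exact sequence `C(-, B) ⟶ C(-, A) ⟶ X ⟶ 0`. -/
def isFinitelyPresentedModule : ObjectProperty (Cᵒᵖ ⥤ AddCommGrpCat.{v}) := fun X =>
  X.Additive ∧
    ∃ (A B : C) (f : preadditiveYoneda.obj B ⟶ preadditiveYoneda.obj A)
      (p : preadditiveYoneda.obj A ⟶ X) (h : f ≫ p = 0),
      (ShortComplex.mk f p h).Exact ∧ Epi p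

/-- `md C`: the category of finitely presented `C`-modules, a full subcategory of the category of
all `C`-modules. -/
abbrev FPModuleCat := (isFinitelyPresentedModule C).FullSubcategory

variable {C} in
/-- The representable functor `C(-, A)` is finitely presented. -/
lemma isFinitelyPresentedModule_preadditiveYoneda (A : C) :
    isFinitelyPresentedModule C (preadditiveYoneda.obj A) := by
  refine ⟨inferInstance, A, A, 0, 𝟙 _, by simp, ?_, inferInstance⟩
  rw [ShortComplex.exact_iff_mono _ rfl]
  dsimp
  infer_instance

variable {C} in
/-- The representable `C`-module `C(-, A)`, as an object of `md C`. -/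
def reprModule (A : C) : FPModuleCat C :=
  ⟨preadditiveYoneda.obj A, isFinitelyPresentedModule_preadditiveYoneda A⟩

/-- `C` is coherent: it has weak kernels and weak cokernels
(a weak cokernel in `C` is a weak kernel in `Cᵒᵖ`). -/
structure IsCoherentCat : Prop where
  hasWeakKernels : HasWeakKernels C
  hasWeakCokernels : HasWeakKernels Cᵒᵖ

/-- `md C` is an abelian category in which every representable module `C(-, A)` has injective
dimension at most `d`. (The additive structure of an abelian category is determined by the
underlying category, so it does not matter which `Abelian` instance is used.) -/
def ReprInjDimLE (d : ℕ) : Prop :=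
  ∃ _ : Abelian (FPModuleCat C), ∀ A : C, HasInjectiveDimensionLE (reprModule A) d

/-- `C` is `d`-Gorenstein: it is coherent, and all representable `C`-modules `C(-, A)` and
`Cᵒᵖ`-modules `C(A, -)` have injective dimension at most `d` in the abelian categories
`md C` and `md Cᵒᵖ`. -/
structure IsGorensteinCat (d : ℕ) : Prop where
  isCoherent : IsCoherentCat C
  injDim_left : ReprInjDimLE C d
  injDim_right : ReprInjDimLE Cᵒᵖ d

end ModulesOverCategories

/-! ### Graded modules over a graded ring -/

section GradedModules

variable {R : Type w} [Ring R]

/-- A `ℤ`-graded left module over a ring `R` with grading `𝒜`. -/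
structure GrMod (𝒜 : ℤ → AddSubgroup R) where
  /-- the underlying module -/
  carrier : Type w
  [addCommGroup : AddCommGroup carrier]
  [module : Module R carrier]
  /-- the homogeneous components -/
  grading : ℤ → AddSubgroup carrier
  isInternal : DirectSum.IsInternal grading
  smul_mem : ∀ {i j : ℤ} {a : R} {x : carrier},
    a ∈ 𝒜 i → x ∈ grading j → a • x ∈ grading (i + j)

attribute [instance] GrMod.addCommGroup GrMod.module

variable {𝒜 : ℤ → AddSubgroup R}

namespace GrMod

/-- Morphisms of graded modules: the linear maps which preserve degrees. -/
@[ext]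
structure Hom (X Y : GrMod 𝒜) where
  /-- the underlying linear map -/
  toLinearMap : X.carrier →ₗ[R] Y.carrier
  map_mem : ∀ {i : ℤ} {x : X.carrier}, x ∈ X.grading i → toLinearMap x ∈ Y.grading i

instance : Category (GrMod 𝒜) where
  Hom := Hom
  id X := ⟨LinearMap.id, fun h => h⟩
  comp f g := ⟨g.toLinearMap.comp f.toLinearMap, fun h => g.map_mem (f.map_mem h)⟩

/-- A graded ring, as a graded left module over itself. -/
def self (𝒜 : ℤ → AddSubgroup R) [GradedRing 𝒜] : GrMod 𝒜 where
  carrier := R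
  grading := 𝒜
  isInternal := DirectSum.Decomposition.isInternal 𝒜
  smul_mem ha hx := SetLike.mul_mem_graded ha hx

end GrMod

variable (𝒜)

/-- Finitely presented graded modules. -/
def isFinitelyPresentedGrMod : ObjectProperty (GrMod 𝒜) := fun X =>
  Module.FinitePresentation R X.carrier

/-- The category of finitely presented graded left modules, with the morphisms of degree zero. -/
abbrev FPGrMod := (isFinitelyPresentedGrMod 𝒜).FullSubcategory

/-- A graded ring, as a finitely presented graded left module over itself. -/
def FPGrMod.self [GradedRing 𝒜] : FPGrMod 𝒜 :=
  ⟨GrMod.self 𝒜, inferInstanceAs (Module.FinitePresentation R R)⟩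

/-- The grading of the opposite ring. Graded left modules over the opposite ring are the
graded right modules. -/
def opGrading : ℤ → AddSubgroup Rᵐᵒᵖ := fun i =>
  (𝒜 i).comap (MulOpposite.opAddEquiv.symm : Rᵐᵒᵖ ≃+ R).toAddMonoidHom

lemma mem_opGrading {i : ℤ} {x : Rᵐᵒᵖ} : x ∈ opGrading 𝒜 i ↔ x.unop ∈ 𝒜 i := Iff.rfl

/-- The identification of the homogeneous components of a ring and of its opposite. -/
def toOpGrading (i : ℤ) : 𝒜 i →+ opGrading 𝒜 i where
  toFun x := ⟨MulOpposite.op x.1, x.2⟩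
  map_zero' := rfl
  map_add' := fun _ _ => rfl

instance [GradedRing 𝒜] : GradedRing (opGrading 𝒜) where
  one_mem := SetLike.one_mem_graded 𝒜
  mul_mem i j a b ha hb := by
    rw [mem_opGrading] at *
    rw [MulOpposite.unop_mul, add_comm i j]
    exact SetLike.mul_mem_graded hb ha
  toDecomposition := DirectSum.Decomposition.ofAddHom (opGrading 𝒜)
    ((DirectSum.map (toOpGrading 𝒜)).comp
      ((DirectSum.decomposeAddEquiv 𝒜).toAddMonoidHom.comp
        (MulOpposite.opAddEquiv.symm : Rᵐᵒᵖ ≃+ R).toAddMonoidHom))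
    (by
      ext r
      induction r using DirectSum.Decomposition.inductionOn 𝒜 with
      | zero => simp
      | homogeneous m => simp [toOpGrading]
      | add a b ha hb => rw [map_add, map_add, ha, hb])
    (by
      ext i ⟨x, hx⟩ : 2
      induction x using MulOpposite.rec' with | _ r =>
      have hr : r ∈ 𝒜 i := hx
      simp [DirectSum.decompose_of_mem 𝒜 hr, toOpGrading])

/-- The graded ring `R` is `d`-Gorenstein: it is left and right graded coherent, that is, the
categories of finitely presented graded left and right `R`-modules are abelian, and `R` has
injective dimension at most `d` in both of them. -/
structure IsGradedGorenstein [GradedRing 𝒜] (d : ℕ) : Prop where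
  left : ∃ _ : Abelian (FPGrMod 𝒜), HasInjectiveDimensionLE (FPGrMod.self 𝒜) d
  right : ∃ _ : Abelian (FPGrMod (opGrading 𝒜)),
    HasInjectiveDimensionLE (FPGrMod.self (opGrading 𝒜)) d

end GradedModules

/-! ### Modules over finite dimensional algebras, the Yoneda category and the Yoneda algebra -/

section FiniteDimensionalAlgebras

/-- `md Λ`: the category of finitely generated left modules over a finite dimensional
`k`-algebra `Λ`. -/
def FDMod (k : Type v) (Λ : Type u) [Field k] [Ring Λ] [Algebra k Λ] [Module.Finite k Λ] :
    Type (u + 1) :=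
  FGModuleCat.{u} Λ

variable (k : Type v) (Λ : Type u) [Field k] [Ring Λ] [Algebra k Λ] [Module.Finite k Λ]

instance : Category.{u} (FDMod k Λ) := inferInstanceAs (Category.{u} (FGModuleCat.{u} Λ))

instance : Abelian (FDMod k Λ) :=
  haveI : IsNoetherianRing Λ := IsNoetherianRing.of_finite k Λ
  inferInstanceAs (Abelian (FGModuleCat.{u} Λ))

instance : HasFiniteBiproducts (FDMod k Λ) := Abelian.hasFiniteBiproducts

/-- The objects of the Yoneda category: `add {A[i] | A ∈ md Λ, i ∈ ℤ}` in the derived category of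
`md Λ`. All of them lie in the bounded derived category, which is a full subcategory closed under
finite direct sums and direct summands. -/
def isYonedaObject [HasDerivedCategory.{w} (FDMod k Λ)] :
    ObjectProperty (DerivedCategory (FDMod k Λ)) :=
  addClosure fun X => ∃ (A : FDMod k Λ) (i : ℤ),
    X = ((DerivedCategory.singleFunctor (FDMod k Λ) 0).obj A)⟦i⟧

/-- The Yoneda category of `Λ`. -/
abbrev YonedaCat [HasDerivedCategory.{w} (FDMod k Λ)] := (isYonedaObject k Λ).FullSubcategory

end FiniteDimensionalAlgebras

section YonedaAlgebra

open CategoryTheory.Abelian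

variable {C : Type u} [Category.{v} C] [Abelian C] [HasExt.{w} C]

/-- The graded pieces of the Yoneda algebra. -/
abbrev YonedaExt (M : C) : ℕ → Type w := fun n => Ext M M n

lemma yonedaExt_mk_comp (M : C) {a b c : ℕ} (x : Ext M M a) (y : Ext M M b) (h : a + b = c) :
    (⟨c, x.comp y h⟩ : GradedMonoid (YonedaExt M)) = ⟨a + b, x.comp y rfl⟩ := by
  subst h; rfl

instance (M : C) : GradedMonoid.GOne (YonedaExt M) := ⟨Ext.mk₀ (𝟙 M)⟩

instance (M : C) : GradedMonoid.GMul (YonedaExt M) := ⟨fun x y => x.comp y rfl⟩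

lemma yonedaExt_mk_mul_mk (M : C) {a b : ℕ} (x : Ext M M a) (y : Ext M M b) :
    GradedMonoid.mk (A := YonedaExt M) a x * GradedMonoid.mk b y =
      GradedMonoid.mk (a + b) (x.comp y rfl) := rfl

instance (M : C) : GradedMonoid.GMonoid (YonedaExt M) where
  one_mul := by
    rintro ⟨n, x⟩
    exact (yonedaExt_mk_comp M (Ext.mk₀ (𝟙 M)) x (zero_add n)).symm.trans
      (congrArg (GradedMonoid.mk n) (Ext.mk₀_id_comp x))
  mul_one := by
    rintro ⟨n, x⟩
    exact congrArg (GradedMonoid.mk n) (Ext.comp_mk₀_id x)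
  mul_assoc := by
    rintro ⟨a, x⟩ ⟨b, y⟩ ⟨c, z⟩
    exact (congrArg (GradedMonoid.mk (a + b + c)) (Ext.comp_assoc x y z rfl rfl rfl)).trans
      (yonedaExt_mk_comp M x (y.comp z rfl) (add_assoc a b c).symm)

/-- The Yoneda product (composition of extensions, written from left to right) makes
`⨁ i, Ext^i(M, M)` a graded ring. -/
instance (M : C) : DirectSum.GRing (YonedaExt M) where
  mul_zero {i j} x := Ext.comp_zero x M j (i + j) rfl
  zero_mul y := Ext.zero_comp M _ y _ rfl
  mul_add x y z := Ext.comp_add x y z _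
  add_mul x y z := Ext.add_comp x y z _
  natCast n := n • Ext.mk₀ (𝟙 M)
  natCast_zero := zero_smul _ _
  natCast_succ n := succ_nsmul _ n
  intCast n := n • Ext.mk₀ (𝟙 M)
  intCast_ofNat n := natCast_zsmul _ n
  intCast_negSucc_ofNat n := negSucc_zsmul _ n

/-- The Yoneda algebra `⨁ i ≥ 0, Ext^i(M, M)`. -/
abbrev YonedaAlgebra (M : C) : Type w := ⨁ n, YonedaExt M n

/-- The grading of the Yoneda algebra, indexed by `ℤ`: the elements of degree `n` are those
concentrated in degree `n`; in particular the components of negative degree are zero. -/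
def yonedaGrading (M : C) : ℤ → AddSubgroup (YonedaAlgebra M) := fun n =>
  { carrier := {x | ∀ j : ℕ, (j : ℤ) ≠ n → x j = 0}
    zero_mem' := fun _ _ => rfl
    add_mem' := fun {x y} hx hy j hj => by
      rw [DirectSum.add_apply, hx j hj, hy j hj, add_zero]
    neg_mem' := fun {x} hx j hj => by
      change -(x j) = 0
      rw [hx j hj, neg_zero] }

lemma mem_yonedaGrading {M : C} {n : ℤ} {x : YonedaAlgebra M} :
    x ∈ yonedaGrading M n ↔ ∀ j : ℕ, (j : ℤ) ≠ n → x j = 0 := Iff.rfl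

lemma of_mem_yonedaGrading (M : C) (n : ℕ) (x : Ext M M n) :
    DirectSum.of (YonedaExt M) n x ∈ yonedaGrading M n := fun j hj =>
  DirectSum.of_eq_of_ne _ _ _ (fun h => hj (by rw [h]))

lemma exists_of_mem_yonedaGrading {M : C} {n : ℤ} {x : YonedaAlgebra M}
    (hx : x ∈ yonedaGrading M n) :
    x = 0 ∨ ∃ (i : ℕ) (y : Ext M M i), (i : ℤ) = n ∧ x = DirectSum.of (YonedaExt M) i y := by
  by_cases hn : ∃ i : ℕ, (i : ℤ) = n
  · obtain ⟨i, rfl⟩ := hn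
    refine Or.inr ⟨i, x i, rfl, ?_⟩
    ext j
    by_cases hj : j = i
    · subst hj
      rw [DirectSum.of_eq_same]
    · rw [DirectSum.of_eq_of_ne _ _ _ hj]
      exact hx j (by exact_mod_cast hj)
  · refine Or.inl ?_
    ext j
    exact hx j (fun h => hn ⟨j, h⟩)

/-- The decomposition of the elements of the Yoneda algebra into homogeneous components. -/
def yonedaDecompose (M : C) : YonedaAlgebra M →+ ⨁ n, yonedaGrading M n :=
  DirectSum.toAddMonoid fun n =>
    (DirectSum.of (fun n => yonedaGrading M n) (n : ℤ)).comp
      ((DirectSum.of (YonedaExt M) n).codRestrict (yonedaGrading M n) (of_mem_yonedaGrading M n))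

lemma yonedaDecompose_of (M : C) (n : ℕ) (x : Ext M M n) :
    yonedaDecompose M (DirectSum.of (YonedaExt M) n x) =
      DirectSum.of (fun n => yonedaGrading M n) (n : ℤ)
        ⟨DirectSum.of (YonedaExt M) n x, of_mem_yonedaGrading M n x⟩ := by
  simp [yonedaDecompose]

instance (M : C) : GradedRing (yonedaGrading M) where
  one_mem := by
    rw [← Nat.cast_zero]
    exact of_mem_yonedaGrading M 0 (Ext.mk₀ (𝟙 M))
  mul_mem i j a b ha hb := by
    obtain rfl | ⟨i, x, rfl, rfl⟩ := exists_of_mem_yonedaGrading ha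
    · rw [zero_mul]
      exact zero_mem _
    obtain rfl | ⟨j, y, rfl, rfl⟩ := exists_of_mem_yonedaGrading hb
    · rw [mul_zero]
      exact zero_mem _
    rw [DirectSum.of_mul_of, ← Nat.cast_add]
    exact of_mem_yonedaGrading M _ _
  toDecomposition := DirectSum.Decomposition.ofAddHom (yonedaGrading M) (yonedaDecompose M)
    (by
      ext n x : 2
      simp [yonedaDecompose_of])
    (by
      ext n ⟨x, hx⟩ : 2
      obtain rfl | ⟨i, y, rfl, rfl⟩ := exists_of_mem_yonedaGrading hx
      · have h : (⟨0, hx⟩ : yonedaGrading M n) = 0 := rfl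
        simp [h]
      · simp [yonedaDecompose_of])

end YonedaAlgebra

end

/-!
Let `C` be an additive category in which every morphism has a weak kernel which is itself a weak
cokernel (`HasReflexiveWeakKernels`). The finitely presented `C`-modules then form an abelian
category, since `C` has weak kernels. In this category `Ext¹(N, C(-, x))` vanishes for every
submodule `N` of a representable module: after covering `N` by a representable module, this says
that the morphisms to `x` from a weak kernel extend when they kill a weak kernel of it. So the
representable modules have injective dimension at most one. Both parts of the theorem are instances
of this argument (`IsPresentedBy.hasInjectiveDimensionLE_one`), which is carried out in any category
`IsPresentedBy` a functor. Part (1) applies it to the Yoneda embedding. Part (2) applies it to the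
functor sending a matrix of homogeneous elements of `Γ` to the corresponding morphism between graded
free modules.

The weak kernels come from a triangulated argument. In a triangulated category, let `U` be the
additive closure of the objects of a heart, placed in all degrees, and assume that the heart has
enough injectives. The cocone `X` of a morphism in `U` is a weak kernel, except that it need not
belong to `U`. If `X` is represented by a complex of injectives, let `W` be the sum of its cycles
and `V` the sum of its boundaries, with zero differentials. The triangle `V ⟶ W ⟶ X ⟶ V⟦1⟧` has its
first two terms in `U`, and `X ⟶ V⟦1⟧` kills all morphisms from objects of `U`
(`IsGradedHeart.exists_resolution`, where complexes of injectives are replaced by an induction with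
octahedra). It follows that `W` is a weak kernel, and that it is also a weak cokernel
(`IsGradedHeart.hasReflexiveWeakKernels`).

The modules over a finite-dimensional algebra have enough injectives, namely the coinduced modules
`Hom_k(Λ, X)`, and enough projectives. The former serve for the derived category with its standard
t-structure, the latter for the opposite category with the opposite t-structure, which yields the
statements about `Uᵒᵖ` and about right modules. Finally, the homogeneous elements of the Yoneda
algebra of `M` are the morphisms between the shifts of `M` in the derived category
(`yonedaFunctor`). If `M` is an additive generator, then these shifts have additive closure `U`, so
that matrices of homogeneous elements inherit reflexive weak kernels from `U`.
-/

noncomputable section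

set_option linter.unusedSectionVars false

/-! ### Categories of finitely presented objects -/

section Presentations

variable {C : Type*} [Category* C] [Preadditive C] {M : Type*} [Category* M] [Preadditive M]

/-- The morphism `p` exhibits `X` as a cokernel of `Φ.map f`, and the sequence
`Φ.obj a ⟶ Φ.obj b ⟶ X ⟶ 0` stays exact after applying `Hom(Φ.obj c, -)`: it is a projective
presentation of `X`, where the objects in the image of `Φ` are the projective ones. -/
structure IsPresentation (Φ : C ⥤ M) {a b : C} (f : a ⟶ b) {X : M} (p : Φ.obj b ⟶ X) : Prop where
  w : Φ.map f ≫ p = 0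
  epi : Epi p
  desc : ∀ {Z : M} (g : Φ.obj b ⟶ Z), Φ.map f ≫ g = 0 → ∃ d : X ⟶ Z, p ≫ d = g
  lift : ∀ {c : C} (g : Φ.obj c ⟶ X), ∃ l : c ⟶ b, Φ.map l ≫ p = g
  exact : ∀ {c : C} (g : c ⟶ b), Φ.map g ≫ p = 0 → ∃ l : c ⟶ a, l ≫ f = g

/-- The category `M` is the category of objects presented by `Φ : C ⥤ M`: all morphisms in the
image of `Φ` have a cokernel which is a projective presentation, and all objects arise so. For a
fully faithful additive `Φ` this characterizes the category of finitely presented `C`-modules. -/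
structure IsPresentedBy (Φ : C ⥤ M) : Prop where
  exists_cokernel : ∀ {a b : C} (f : a ⟶ b), ∃ (X : M) (p : Φ.obj b ⟶ X), IsPresentation Φ f p
  exists_presentation : ∀ X : M, ∃ (a b : C) (f : a ⟶ b) (p : Φ.obj b ⟶ X), IsPresentation Φ f p

/-- Every morphism `f` has a weak kernel `g` which is also a weak cokernel, of some `h`. -/
def HasReflexiveWeakKernels (C : Type*) [Category* C] [Preadditive C] : Prop :=
  ∀ ⦃a b : C⦄ (f : a ⟶ b), ∃ (c d : C) (g : c ⟶ a) (h : d ⟶ c), g ≫ f = 0 ∧ h ≫ g = 0 ∧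
    (∀ {x : C} (t : x ⟶ a), t ≫ f = 0 → ∃ l : x ⟶ c, l ≫ g = t) ∧
    (∀ {x : C} (t : c ⟶ x), h ≫ t = 0 → ∃ l : a ⟶ x, g ≫ l = t)

/-- Weak kernels, in elementary terms: through `g` factors every morphism killed by `f`. -/
def WeakKernelsExist (C : Type*) [Category* C] [Preadditive C] : Prop :=
  ∀ ⦃a b : C⦄ (f : a ⟶ b), ∃ (c : C) (g : c ⟶ a), g ≫ f = 0 ∧
    ∀ {x : C} (t : x ⟶ a), t ≫ f = 0 → ∃ l : x ⟶ c, l ≫ g = t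

lemma HasReflexiveWeakKernels.weakKernelsExist (hC : HasReflexiveWeakKernels C) :
    WeakKernelsExist C := fun _ _ f => by
  obtain ⟨c, d, g, h, w, -, hg, -⟩ := hC f
  exact ⟨c, g, w, hg⟩

lemma WeakKernelsExist.hasWeakKernels (hC : WeakKernelsExist C) : HasWeakKernels C where
  hasWeakLimit f := by
    obtain ⟨c, g, w, hg⟩ := hC f
    exact ⟨⟨⟨KernelFork.ofι g w, Fork.IsWeakLimit.mk' _ fun s =>
      ⟨_, (hg s.ι (KernelFork.condition s)).choose_spec⟩⟩⟩⟩

namespace IsPresentedBy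

variable {Φ : C ⥤ M}

/-- Two morphisms agree if they agree on all morphisms from the projectives `Φ.obj c`. -/
lemma hom_ext (hΦ : IsPresentedBy Φ) {X Y : M} {f g : X ⟶ Y}
    (h : ∀ {c : C} (t : Φ.obj c ⟶ X), t ≫ f = t ≫ g) : f = g := by
  obtain ⟨a, b, r, p, hp⟩ := hΦ.exists_presentation X
  have := hp.epi
  exact (cancel_epi p).1 (h p)

lemma mono_of (hΦ : IsPresentedBy Φ) {X Y : M} (f : X ⟶ Y)
    (h : ∀ {c : C} (t : Φ.obj c ⟶ X), t ≫ f = 0 → t = 0) : Mono f :=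
  Preadditive.mono_of_cancel_zero _ fun g hg => hΦ.hom_ext fun t => by
    rw [comp_zero]
    exact h _ (by rw [Category.assoc, hg, comp_zero])

lemma hasZeroObject [HasZeroObject C] (hΦ : IsPresentedBy Φ) : HasZeroObject M := by
  obtain ⟨X, p, hp⟩ := hΦ.exists_cokernel (𝟙 (Classical.choose (HasZeroObject.zero (C := C))))
  have := hp.epi
  refine ⟨X, (IsZero.iff_id_eq_zero X).2 ?_⟩
  rw [← cancel_epi p]
  have := hp.w
  rw [Φ.map_id, Category.id_comp] at this
  simp [this]

variable [Φ.Full] [Φ.Additive] [HasBinaryBiproducts C]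

/-- Every morphism has a cokernel, and the cokernel sequence stays exact after applying
`Hom(Φ.obj c, -)`. If `X` and `Y` are presented by `r : a₁ ⟶ a₀` and `s : b₁ ⟶ b₀` and `f` lifts
to `l : a₀ ⟶ b₀`, then the cokernel of `f` is presented by `(s, l) : b₁ ⊞ a₀ ⟶ b₀`. -/
lemma exists_cokernel_hom (hΦ : IsPresentedBy Φ) {X Y : M} (f : X ⟶ Y) :
    ∃ (Z : M) (q : Y ⟶ Z) (w : f ≫ q = 0), Nonempty (IsColimit (CokernelCofork.ofπ q w)) ∧
      (∀ {c : C} (g : Φ.obj c ⟶ Z), ∃ l : Φ.obj c ⟶ Y, l ≫ q = g) ∧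
      (∀ {c : C} (g : Φ.obj c ⟶ Y), g ≫ q = 0 → ∃ l : Φ.obj c ⟶ X, l ≫ f = g) := by
  obtain ⟨a₁, a₀, r, p, hp⟩ := hΦ.exists_presentation X
  obtain ⟨b₁, b₀, s, q, hq⟩ := hΦ.exists_presentation Y
  obtain ⟨l, hl⟩ := hq.lift (p ≫ f)
  obtain ⟨Z, z, hz⟩ := hΦ.exists_cokernel (biprod.desc s l)
  have := hp.epi
  have := hq.epi
  have := hz.epi
  have hsz : Φ.map s ≫ z = 0 := by
    rw [← biprod.inl_desc s l, Φ.map_comp, Category.assoc, hz.w, comp_zero]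
  have hlz : Φ.map l ≫ z = 0 := by
    rw [← biprod.inr_desc s l, Φ.map_comp, Category.assoc, hz.w, comp_zero]
  obtain ⟨e, he⟩ := hq.desc z hsz
  have hfe : f ≫ e = 0 := by
    rw [← cancel_epi p, ← Category.assoc, ← hl, Category.assoc, he, hlz, comp_zero]
  have : Epi e := by
    have : Epi (q ≫ e) := by rw [he]; infer_instance
    exact epi_of_epi q e
  refine ⟨Z, e, hfe, ⟨CokernelCofork.IsColimit.ofπ' _ _ fun {W} k hk => ?_⟩, fun g => ?_,
    fun {c} g hg => ?_⟩
  · have hd := hz.desc (q ≫ k) (by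
      rw [← Category.assoc]
      suffices h : Φ.map (biprod.desc s l) ≫ q = Φ.map biprod.snd ≫ p ≫ f by
        rw [h, Category.assoc, Category.assoc, hk, comp_zero, comp_zero]
      rw [biprod.desc_eq, Φ.map_add, Preadditive.add_comp, Φ.map_comp, Φ.map_comp, Category.assoc,
        hq.w, comp_zero, zero_add, Category.assoc, hl])
    refine ⟨hd.choose, ?_⟩
    rw [← cancel_epi q, ← Category.assoc, he, hd.choose_spec]
  · obtain ⟨t, ht⟩ := hz.lift g
    exact ⟨Φ.map t ≫ q, by rw [Category.assoc, he, ht]⟩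
  · obtain ⟨t, ht⟩ := hq.lift g
    obtain ⟨t', ht'⟩ := hz.exact t (by rw [← he, ← Category.assoc, ht, hg])
    refine ⟨Φ.map (t' ≫ biprod.snd) ≫ p, ?_⟩
    rw [← ht, ← ht', biprod.desc_eq, Preadditive.comp_add, Φ.map_add, Preadditive.add_comp,
      ← Category.assoc t', ← Category.assoc t', Φ.map_comp _ s, Φ.map_comp _ l, Category.assoc,
      Category.assoc, hq.w, comp_zero, zero_add, Category.assoc, hl]

lemma hasCokernels (hΦ : IsPresentedBy Φ) : HasCokernels M where
  has_colimit f := by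
    obtain ⟨Z, q, w, ⟨h⟩, -⟩ := hΦ.exists_cokernel_hom f
    exact ⟨⟨⟨_, h⟩⟩⟩

/-- The objects `Φ.obj c` are projective. -/
lemma exists_lift_of_epi (hΦ : IsPresentedBy Φ) {X Y : M} (f : X ⟶ Y) [Epi f] {c : C}
    (g : Φ.obj c ⟶ Y) : ∃ l : Φ.obj c ⟶ X, l ≫ f = g := by
  obtain ⟨Z, q, w, -, -, h⟩ := hΦ.exists_cokernel_hom f
  refine h g ?_
  rw [(cancel_epi f).1 (w.trans comp_zero.symm), comp_zero]

/-- The direct sum of two objects is presented by the direct sum of their presentations. -/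
lemma hasBinaryBiproducts (hΦ : IsPresentedBy Φ) : HasBinaryBiproducts M where
  has_binary_biproduct X Y := by
    obtain ⟨a₁, a₀, r, p, hp⟩ := hΦ.exists_presentation X
    obtain ⟨b₁, b₀, s, q, hq⟩ := hΦ.exists_presentation Y
    obtain ⟨Z, z, hz⟩ := hΦ.exists_cokernel (biprod.map r s)
    have := hp.epi
    have := hq.epi
    have := hz.epi
    obtain ⟨i, hi⟩ := hp.desc (Φ.map biprod.inl ≫ z) (by
      rw [← Category.assoc, ← Φ.map_comp, ← biprod.inl_map r s, Φ.map_comp, Category.assoc, hz.w,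
        comp_zero])
    obtain ⟨j, hj⟩ := hq.desc (Φ.map biprod.inr ≫ z) (by
      rw [← Category.assoc, ← Φ.map_comp, ← biprod.inr_map r s, Φ.map_comp, Category.assoc, hz.w,
        comp_zero])
    obtain ⟨π, hπ⟩ := hz.desc (Φ.map biprod.fst ≫ p) (by
      rw [← Category.assoc, ← Φ.map_comp, biprod.map_fst, Φ.map_comp, Category.assoc, hp.w,
        comp_zero])
    obtain ⟨ρ, hρ⟩ := hz.desc (Φ.map biprod.snd ≫ q) (by
      rw [← Category.assoc, ← Φ.map_comp, biprod.map_snd, Φ.map_comp, Category.assoc, hq.w,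
        comp_zero])
    let b : BinaryBicone X Y :=
      { pt := Z, fst := π, snd := ρ, inl := i, inr := j
        inl_fst := by
          rw [← cancel_epi p, ← Category.assoc, hi, Category.assoc, hπ, ← Category.assoc,
            ← Φ.map_comp]
          simp
        inl_snd := by
          rw [← cancel_epi p, ← Category.assoc, hi, Category.assoc, hρ, ← Category.assoc,
            ← Φ.map_comp]
          simp
        inr_fst := by
          rw [← cancel_epi q, ← Category.assoc, hj, Category.assoc, hπ, ← Category.assoc,
            ← Φ.map_comp]
          simp
        inr_snd := by
          rw [← cancel_epi q, ← Category.assoc, hj, Category.assoc, hρ, ← Category.assoc,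
            ← Φ.map_comp]
          simp }
    refine HasBinaryBiproduct.mk ⟨b, isBinaryBilimitOfTotal b ?_⟩
    change π ≫ i + ρ ≫ j = 𝟙 Z
    rw [← cancel_epi z, Preadditive.comp_add, ← Category.assoc, hπ, ← Category.assoc, hρ,
      Category.assoc, hi, Category.assoc, hj, ← Category.assoc, ← Category.assoc, ← Φ.map_comp,
      ← Φ.map_comp, ← Preadditive.add_comp, ← Φ.map_add, biprod.total]
    simp

lemma hasFiniteProducts [HasZeroObject C] (hΦ : IsPresentedBy Φ) : HasFiniteProducts M := by
  have := hΦ.hasBinaryBiproducts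
  have := hΦ.hasZeroObject
  exact hasFiniteProducts_of_has_binary_and_terminal

/-- If `C` has weak kernels, then for every morphism `f` of `M` there is a morphism from some
`Φ.obj c` through which all morphisms `Φ.obj x ⟶ X` killed by `f` factor. It comes from a weak
kernel of `(l, s) : a₀ ⊞ b₁ ⟶ b₀`, where `s : b₁ ⟶ b₀` presents `Y` and `l : a₀ ⟶ b₀` lifts `f`. -/
lemma exists_weakKernel (hΦ : IsPresentedBy Φ) (hC : WeakKernelsExist C) {X Y : M}
    (f : X ⟶ Y) :
    ∃ (c : C) (k : Φ.obj c ⟶ X), k ≫ f = 0 ∧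
      ∀ {x : C} (t : Φ.obj x ⟶ X), t ≫ f = 0 → ∃ l : x ⟶ c, Φ.map l ≫ k = t := by
  obtain ⟨a₁, a₀, r, p, hp⟩ := hΦ.exists_presentation X
  obtain ⟨b₁, b₀, s, q, hq⟩ := hΦ.exists_presentation Y
  obtain ⟨l, hl⟩ := hq.lift (p ≫ f)
  obtain ⟨c, g, hg, hg'⟩ := hC (biprod.desc l s)
  refine ⟨c, Φ.map (g ≫ biprod.fst) ≫ p, ?_, fun t ht => ?_⟩
  · rw [Category.assoc, ← hl, ← Category.assoc, ← Φ.map_comp, Category.assoc]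
    have h : g ≫ biprod.fst ≫ l = (-(g ≫ biprod.snd)) ≫ s := by
      rw [biprod.desc_eq, Preadditive.comp_add] at hg
      rw [eq_neg_of_add_eq_zero_left hg, Preadditive.neg_comp, Category.assoc]
    rw [h, Φ.map_comp, Category.assoc, hq.w, comp_zero]
  · obtain ⟨t', rfl⟩ := hp.lift t
    obtain ⟨m, hm⟩ := hq.exact (t' ≫ l) (by
      rw [Φ.map_comp, Category.assoc, hl, ← Category.assoc, ht])
    obtain ⟨n, hn⟩ := hg' (biprod.lift t' (-m)) (by
      rw [biprod.lift_desc, Preadditive.neg_comp, hm, add_neg_cancel])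
    refine ⟨n, ?_⟩
    rw [← Category.assoc, ← Φ.map_comp, ← Category.assoc, hn, biprod.lift_fst]

/-- The kernel of `f` is the object presented by the weak kernel of a weak kernel of `f`. -/
lemma hasKernels (hΦ : IsPresentedBy Φ) (hC : WeakKernelsExist C) : HasKernels M where
  has_limit {X Y} f := by
    obtain ⟨c, k, hk, hk'⟩ := hΦ.exists_weakKernel hC f
    obtain ⟨d, h, hh, hh'⟩ := hΦ.exists_weakKernel hC k
    obtain ⟨h, rfl⟩ := Φ.map_surjective h
    obtain ⟨N, p, hp⟩ := hΦ.exists_cokernel h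
    have := hp.epi
    obtain ⟨m, hm⟩ := hp.desc k hh
    have hmf : m ≫ f = 0 := by
      rw [← cancel_epi p, ← Category.assoc, hm, hk, comp_zero]
    have : Mono m := hΦ.mono_of m fun t ht => by
      obtain ⟨t, rfl⟩ := hp.lift t
      obtain ⟨l, hl⟩ := hh' (Φ.map t) (by rw [← hm, ← Category.assoc, ht])
      rw [← hl, Category.assoc, hp.w, comp_zero]
    refine ⟨⟨KernelFork.ofι m hmf, KernelFork.IsLimit.ofι' _ _ fun {Z} g hg => ?_⟩⟩
    have hd : ∃ d : Z ⟶ N, d ≫ m = g := by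
      obtain ⟨a₁, a₀, r, q, hq⟩ := hΦ.exists_presentation Z
      have := hq.epi
      obtain ⟨l, hl⟩ := hk' (q ≫ g) (by rw [Category.assoc, hg, comp_zero])
      obtain ⟨d, hd⟩ := hq.desc (Φ.map l ≫ p) (by
        rw [← cancel_mono m, Category.assoc, Category.assoc, hm, hl, ← Category.assoc, hq.w,
          zero_comp, zero_comp])
      exact ⟨d, by rw [← cancel_epi q, ← Category.assoc, hd, Category.assoc, hm, hl]⟩
    exact ⟨hd.choose, hd.choose_spec⟩

lemma isNormalMonoCategory (hΦ : IsPresentedBy Φ) : IsNormalMonoCategory M where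
  normalMonoOfMono {X Y} m _ := by
    obtain ⟨Z, q, w, -, -, hm⟩ := hΦ.exists_cokernel_hom m
    refine ⟨⟨Z, q, w, KernelFork.IsLimit.ofι' _ _ fun {W} g hg => ?_⟩⟩
    have hd : ∃ d : W ⟶ X, d ≫ m = g := by
      obtain ⟨a₁, a₀, r, p, hp⟩ := hΦ.exists_presentation W
      have := hp.epi
      obtain ⟨l, hl⟩ := hm (p ≫ g) (by rw [Category.assoc, hg, comp_zero])
      obtain ⟨d, hd⟩ := hp.desc l (by
        rw [← cancel_mono m, Category.assoc, hl, ← Category.assoc, hp.w, zero_comp, zero_comp])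
      exact ⟨d, by rw [← cancel_epi p, ← Category.assoc, hd, hl]⟩
    exact ⟨hd.choose, hd.choose_spec⟩

lemma isNormalEpiCategory (hΦ : IsPresentedBy Φ) (hC : WeakKernelsExist C) :
    IsNormalEpiCategory M where
  normalEpiOfEpi {X Y} e _ := by
    obtain ⟨c, k, hk, hk'⟩ := hΦ.exists_weakKernel hC e
    refine ⟨⟨Φ.obj c, k, hk, CokernelCofork.IsColimit.ofπ' _ _ fun {Z} g hg => ?_⟩⟩
    have hd : ∃ d : Y ⟶ Z, e ≫ d = g := by
      obtain ⟨b₁, b₀, s, q, hq⟩ := hΦ.exists_presentation Y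
      have := hq.epi
      obtain ⟨l, hl⟩ := hΦ.exists_lift_of_epi e q
      -- `g` kills everything killed by `e`, as such morphisms factor through `k`.
      have hkill {x : C} (t : Φ.obj x ⟶ X) (ht : t ≫ e = 0) : t ≫ g = 0 := by
        obtain ⟨n, rfl⟩ := hk' t ht
        rw [Category.assoc, hg, comp_zero]
      obtain ⟨d, hd⟩ := hq.desc (l ≫ g) (by
        rw [← Category.assoc]
        exact hkill _ (by rw [Category.assoc, hl, hq.w]))
      refine ⟨d, hΦ.hom_ext fun t => ?_⟩
      obtain ⟨u, hu⟩ := hq.lift (t ≫ e)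
      have h := hkill (Φ.map u ≫ l - t) (by
        rw [Preadditive.sub_comp, Category.assoc, hl, hu, sub_self])
      rw [Preadditive.sub_comp, sub_eq_zero] at h
      rw [← h, ← Category.assoc, ← hu, Category.assoc, hd, Category.assoc]
    exact ⟨hd.choose, hd.choose_spec⟩

/-- A category presented by a category with weak kernels is abelian. -/
@[reducible]
def abelian [HasZeroObject C] (hΦ : IsPresentedBy Φ) (hC : WeakKernelsExist C) : Abelian M :=
  { toPreadditive := inferInstance
    toIsNormalMonoCategory := hΦ.isNormalMonoCategory
    toIsNormalEpiCategory := hΦ.isNormalEpiCategory hC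
    has_finite_products := hΦ.hasFiniteProducts
    has_kernels := hΦ.hasKernels hC
    has_cokernels := hΦ.hasCokernels }

/-- If `C` has reflexive weak kernels, then the projectives `Φ.obj x` have injective dimension at
most `1`. Indeed `Ext¹(N, Φ.obj x)` vanishes for all `N` contained in some `Φ.obj b`: choose an
epimorphism `q : Φ.obj b' ⟶ N` and a weak kernel `g : c ⟶ b'` of the composition `b' ⟶ b` which is
also a weak cokernel. A morphism `ker q ⟶ Φ.obj x` gives a morphism `c ⟶ x` by composition with
`Φ.obj c ⟶ ker q`, and this extends along `g` to `b'`. -/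
lemma hasInjectiveDimensionLE_one [Φ.Faithful] [HasZeroObject C] (hΦ : IsPresentedBy Φ)
    (hC : HasReflexiveWeakKernels C) (x : C) :
    letI := hΦ.abelian hC.weakKernelsExist
    HasInjectiveDimensionLE (Φ.obj x) 1 := by
  let := hΦ.abelian hC.weakKernelsExist
  let := HasExt.standard M
  have hproj (c : C) : Projective (Φ.obj c) := ⟨fun g e _ => hΦ.exists_lift_of_epi e g⟩
  have : EnoughProjectives M := ⟨fun X => by
    obtain ⟨a, b, f, p, hp⟩ := hΦ.exists_presentation X
    have := hp.epi
    exact ⟨⟨Φ.obj b, p⟩⟩⟩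
  refine hasInjectiveDimensionLT_of_enoughProjectives _ _ fun X => ⟨fun e₁ e₂ => ?_⟩
  -- By dimension shifting along `p`, a class in `Ext²(X, Φ.obj x)` comes from `Ext¹(kernel p, -)`.
  suffices h : ∀ e : Abelian.Ext X (Φ.obj x) 2, e = 0 by rw [h e₁, h e₂]
  intro e
  obtain ⟨a, b, f, p, hp⟩ := hΦ.exists_presentation X
  have := hp.epi
  have h₁ : (ShortComplex.mk _ _ (kernel.condition p)).ShortExact :=
    { exact := ShortComplex.exact_kernel p }
  obtain ⟨e, rfl⟩ := Abelian.Ext.contravariant_sequence_exact₃ h₁ (Φ.obj x) e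
    (Abelian.Ext.eq_zero_of_projective _) (by rfl : 1 + 1 = 2)
  suffices he : e = 0 by rw [he, Abelian.Ext.comp_zero]
  obtain ⟨a', b', f', q, hq⟩ := hΦ.exists_presentation (kernel p)
  have := hq.epi
  have h₂ : (ShortComplex.mk _ _ (kernel.condition q)).ShortExact :=
    { exact := ShortComplex.exact_kernel q }
  obtain ⟨t, rfl⟩ := Abelian.Ext.contravariant_sequence_exact₃ h₂ (Φ.obj x) e
    (Abelian.Ext.eq_zero_of_projective _) (by rfl : 1 + 0 = 1)
  obtain ⟨t, rfl⟩ := Abelian.Ext.homEquiv₀.symm.surjective t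
  obtain ⟨r, hr⟩ := Φ.map_surjective (q ≫ kernel.ι p)
  obtain ⟨c, d, g, h, hgr, hhg, hg, hh⟩ := hC r
  have hgq : Φ.map g ≫ q = 0 := by
    rw [← cancel_mono (kernel.ι p), Category.assoc, ← hr, ← Φ.map_comp, hgr, Φ.map_zero, zero_comp]
  obtain ⟨s, hs⟩ := Φ.map_surjective (kernel.lift q _ hgq ≫ t)
  obtain ⟨l, hl⟩ := hh s (by
    apply Φ.map_injective
    have : Φ.map h ≫ kernel.lift q _ hgq = 0 := by
      rw [← cancel_mono (kernel.ι q), Category.assoc, kernel.lift_ι, ← Φ.map_comp, hhg, Φ.map_zero,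
        zero_comp]
    rw [Φ.map_comp, hs, ← Category.assoc, this, zero_comp, Φ.map_zero])
  -- The extension `l` of `s` to `b'` extends `t`, as `Φ.obj c` covers the kernel of `q`.
  have ht : t = kernel.ι q ≫ Φ.map l := hΦ.hom_ext fun {z} y => by
    obtain ⟨y', hy'⟩ := Φ.map_surjective (y ≫ kernel.ι q)
    obtain ⟨n, hn⟩ := hg y' (by
      apply Φ.map_injective
      rw [Φ.map_comp, hr, hy', Category.assoc, ← Category.assoc (kernel.ι q), kernel.condition,
        zero_comp, comp_zero, Φ.map_zero])
    have hy : y = Φ.map n ≫ kernel.lift q _ hgq := by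
      rw [← cancel_mono (kernel.ι q), Category.assoc, kernel.lift_ι, ← Φ.map_comp, hn, hy']
    rw [hy, Category.assoc, ← hs, ← hl, Category.assoc, ← Category.assoc (kernel.lift q _ hgq),
      kernel.lift_ι, Φ.map_comp]
  rw [ht, Abelian.Ext.homEquiv₀_symm_apply, ← Abelian.Ext.mk₀_comp_mk₀]
  exact h₂.extClass_comp_assoc (Abelian.Ext.mk₀ (Φ.map l))

end IsPresentedBy

end Presentations

/-! ### Finitely presented modules over a preadditive category -/

section FinitelyPresentedModules

variable {C : Type u} [Category.{v} C] [Preadditive C]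

variable (C) in
/-- The Yoneda embedding of `C` into the category of finitely presented `C`-modules. -/
abbrev reprFunctor : C ⥤ FPModuleCat C :=
  (isFinitelyPresentedModule C).lift preadditiveYoneda isFinitelyPresentedModule_preadditiveYoneda

instance : (reprFunctor C).Additive where
  map_add {X Y f g} := by
    apply ObjectProperty.hom_ext
    ext Z t
    exact Preadditive.comp_add _ _ _ t f g

lemma preadditiveYoneda_hom_ext {A : C} {X : Cᵒᵖ ⥤ AddCommGrpCat.{v}}
    {f g : preadditiveYoneda.obj A ⟶ X}
    (h : f.app (Opposite.op A) (𝟙 A) = g.app (Opposite.op A) (𝟙 A)) : f = g := by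
  ext B t
  have e (k : preadditiveYoneda.obj A ⟶ X) :
      k.app B t = X.map t.op (k.app (Opposite.op A) (𝟙 A)) := by
    have := ConcreteCategory.congr_hom (k.naturality t.op) (𝟙 A)
    refine Eq.trans ?_ this
    exact congrArg (k.app B) (Category.comp_id t).symm
  rw [e, e, h]

/-- By the Yoneda lemma, sections of `X` over `c` are the morphisms from `C(-, c)` to `X`, so that
an exact sequence of functors, being exact pointwise, is a projective presentation. -/
lemma isPresentation_reprFunctor {a b : C} (f : a ⟶ b) {X : FPModuleCat C}
    (p : (reprFunctor C).obj b ⟶ X) (w : preadditiveYoneda.map f ≫ p.hom = 0)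
    (hp : (ShortComplex.mk _ _ w).Exact) [Epi p.hom] : IsPresentation (reprFunctor C) f p where
  w := ObjectProperty.hom_ext _ w
  epi := (isFinitelyPresentedModule C).ι.epi_of_epi_map (inferInstanceAs (Epi p.hom))
  desc {Z} g hg := by
    have : Epi (ShortComplex.mk _ _ w).g := ‹Epi p.hom›
    have hg' : (ShortComplex.mk _ _ w).f ≫ g.hom = 0 := congrArg (·.hom) hg
    exact ⟨ObjectProperty.homMk (hp.desc g.hom hg'), ObjectProperty.hom_ext _ (hp.g_desc g.hom hg')⟩
  lift {c} g := by
    have h : Function.Surjective (p.hom.app (Opposite.op c)) :=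
      (AddCommGrpCat.epi_iff_surjective _).1 inferInstance
    obtain ⟨l, hl⟩ := h (g.hom.app (Opposite.op c) (𝟙 c))
    refine ⟨l, ObjectProperty.hom_ext _ (preadditiveYoneda_hom_ext ?_)⟩
    refine Eq.trans ?_ hl
    exact congrArg (p.hom.app (Opposite.op c)) (Category.id_comp l)
  exact {c} g hg := by
    have h := hp.map ((evaluation Cᵒᵖ AddCommGrpCat.{v}).obj (Opposite.op c))
    rw [ShortComplex.ab_exact_iff] at h
    refine h g ?_
    have := ConcreteCategory.congr_hom
      (congrArg (fun k : (reprFunctor C).obj c ⟶ X => k.hom.app (Opposite.op c)) hg) (𝟙 c)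
    refine Eq.trans ?_ this
    exact congrArg (p.hom.app (Opposite.op c)) (Category.id_comp g).symm

variable (C) in
lemma isPresentedBy_reprFunctor : IsPresentedBy (reprFunctor C) where
  exists_cokernel {a b} f := by
    let p := cokernel.π (preadditiveYoneda.map f)
    have hp : (ShortComplex.mk _ _ (cokernel.condition (preadditiveYoneda.map f))).Exact :=
      ShortComplex.exact_cokernel _
    have hX : isFinitelyPresentedModule C (cokernel (preadditiveYoneda.map f)) := by
      refine ⟨⟨fun {A B s t} => ?_⟩, b, a, preadditiveYoneda.map f, p, _, hp, inferInstance⟩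
      rw [← cancel_epi (p.app A), Preadditive.comp_add, ← p.naturality, ← p.naturality,
        ← p.naturality, Functor.map_add, Preadditive.add_comp]
    refine ⟨⟨_, hX⟩, ObjectProperty.homMk p, ?_⟩
    have : Epi (ObjectProperty.homMk p : (reprFunctor C).obj b ⟶ ⟨_, hX⟩).hom :=
      inferInstanceAs (Epi p)
    exact isPresentation_reprFunctor f _ (cokernel.condition (preadditiveYoneda.map f)) hp
  exists_presentation X := by
    obtain ⟨b, a, f, p, w, hp, _⟩ := X.property.2
    obtain ⟨f, rfl⟩ := preadditiveYoneda.map_surjective f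
    have : Epi (ObjectProperty.homMk p : (reprFunctor C).obj b ⟶ X).hom := inferInstanceAs (Epi p)
    exact ⟨a, b, f, ObjectProperty.homMk p, isPresentation_reprFunctor f _ w hp⟩

/-- Over a category with reflexive weak kernels, the finitely presented modules form an abelian
category, in which the representable modules have injective dimension at most one. -/
lemma HasReflexiveWeakKernels.reprInjDimLE [HasBinaryBiproducts C] [HasZeroObject C]
    (hC : HasReflexiveWeakKernels C) : ReprInjDimLE C 1 :=
  ⟨(isPresentedBy_reprFunctor C).abelian hC.weakKernelsExist, fun A =>
    (isPresentedBy_reprFunctor C).hasInjectiveDimensionLE_one hC A⟩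

end FinitelyPresentedModules

/-! ### Extending functors to matrices -/

section MatrixFunctor

variable {C : Type*} [Category* C] [Preadditive C] {D : Type*} [Category* D] [Preadditive D]
  [HasFiniteBiproducts D]

lemma biproduct_matrix_add {ι κ : Type} [Finite ι] [Finite κ] {X : ι → D} {Y : κ → D}
    (m n : ∀ i j, X i ⟶ Y j) :
    biproduct.matrix (fun i j => m i j + n i j) = biproduct.matrix m + biproduct.matrix n := by
  ext i j
  simp [Preadditive.add_comp, Preadditive.comp_add]

/-- The additive functor from the additive envelope of `C` which extends an additive functor
`F : C ⥤ D`. (In contrast with `Mat_.lift`, there are no constraints on the universes.) -/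
abbrev matExtend (F : C ⥤ D) [F.Additive] : Mat_ C ⥤ D where
  obj X := ⨁ fun i => F.obj (X.X i)
  map f := biproduct.matrix fun i j => F.map (f i j)
  map_id X := by
    ext i j
    by_cases h : j = i
    · subst h; simp
    · simp [h]
  map_comp f g := by
    ext i j
    simp [biproduct.lift_desc]

instance (F : C ⥤ D) [F.Additive] : (matExtend F).Additive where
  map_add {X Y f g} := by
    have h : (fun i j => F.map ((f + g) i j)) = fun i j => F.map (f i j) + F.map (g i j) :=
      funext₂ fun i j => F.map_add
    exact (congrArg biproduct.matrix h).trans (biproduct_matrix_add _ _)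

instance (F : C ⥤ D) [F.Additive] [F.Faithful] : (matExtend F).Faithful where
  map_injective {X Y f g} h := by
    ext i j
    apply F.map_injective
    have := congrArg (fun k => biproduct.components k i j) h
    simpa using this

instance (F : C ⥤ D) [F.Additive] [F.Full] : (matExtend F).Full where
  map_surjective {X Y} f :=
    ⟨fun i j => F.preimage (biproduct.components (f := fun i => F.obj (X.X i))
      (g := fun j => F.obj (Y.X j)) f i j), by
      change biproduct.matrix (fun i j => F.map (F.preimage _)) = _
      simp only [F.map_preimage]
      exact biproduct.components_matrix (f := fun i => F.obj (X.X i))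
        (g := fun j => F.obj (Y.X j)) f⟩

end MatrixFunctor

/-! ### Gradings from projections -/

section InternalGradings

variable {X : Type*} [AddCommGroup X]

/-- A family of subgroups is an internal grading as soon as there are projections onto them. -/
lemma isInternal_of_projections (G : ℤ → AddSubgroup X) (p : ℤ → X →+ X) (hp : ∀ i x, p i x ∈ G i)
    (hp_same : ∀ i, ∀ x ∈ G i, p i x = x) (hp_ne : ∀ i j, i ≠ j → ∀ x ∈ G i, p j x = 0)
    (hp_sum : ∀ x, ∃ s : Finset ℤ, ∑ i ∈ s, p i x = x) : DirectSum.IsInternal G := by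
  have key (y : ⨁ i, G i) (j : ℤ) : p j (DirectSum.coeAddMonoidHom G y) = y j := by
    induction y using DirectSum.induction_on with
    | zero => simp
    | of i x =>
      rw [DirectSum.coeAddMonoidHom_of]
      by_cases h : i = j
      · subst h
        rw [hp_same _ _ x.2, DirectSum.of_eq_same]
      · rw [hp_ne _ _ h _ x.2, DirectSum.of_eq_of_ne _ _ _ (Ne.symm h)]
        rfl
    | add y z hy hz =>
      rw [map_add, map_add, hy, hz]
      rfl
  refine ⟨(injective_iff_map_eq_zero _).2 fun y hy => ?_, fun x => ?_⟩
  · ext j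
    rw [← key, hy, map_zero]
    rfl
  · obtain ⟨s, hs⟩ := hp_sum x
    refine ⟨∑ i ∈ s, DirectSum.of (fun i => G i) i ⟨p i x, hp i x⟩, ?_⟩
    rw [map_sum]
    simpa using hs

end InternalGradings

/-! ### The category of graded modules -/

section GradedModuleCategory

variable {R : Type w} [Ring R] {𝒜 : ℤ → AddSubgroup R}

namespace GrMod

section Hom

variable {X Y : GrMod 𝒜}

lemma Hom.toLinearMap_injective :
    Function.Injective (Hom.toLinearMap (X := X) (Y := Y)) :=
  fun _ _ => Hom.ext

instance : Zero (Hom X Y) := ⟨⟨0, fun _ => zero_mem _⟩⟩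

instance : Add (Hom X Y) :=
  ⟨fun f g => ⟨f.toLinearMap + g.toLinearMap, fun h => add_mem (f.map_mem h) (g.map_mem h)⟩⟩

instance : Neg (Hom X Y) := ⟨fun f => ⟨-f.toLinearMap, fun h => neg_mem (f.map_mem h)⟩⟩

instance : Sub (Hom X Y) :=
  ⟨fun f g => ⟨f.toLinearMap - g.toLinearMap, fun h => sub_mem (f.map_mem h) (g.map_mem h)⟩⟩

instance : SMul ℕ (Hom X Y) :=
  ⟨fun n f => ⟨n • f.toLinearMap, fun h => nsmul_mem (f.map_mem h) n⟩⟩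

instance : SMul ℤ (Hom X Y) :=
  ⟨fun n f => ⟨n • f.toLinearMap, fun h => zsmul_mem (f.map_mem h) n⟩⟩

instance : AddCommGroup (Hom X Y) :=
  Hom.toLinearMap_injective.addCommGroup _ rfl (fun _ _ => rfl) (fun _ => rfl) (fun _ _ => rfl)
    (fun _ _ => rfl) (fun _ _ => rfl)

end Hom

instance : Preadditive (GrMod 𝒜) where
  homGroup X Y := inferInstanceAs (AddCommGroup (Hom X Y))
  add_comp _ _ _ _ _ _ := Hom.ext (LinearMap.comp_add _ _ _)
  comp_add _ _ _ _ _ _ := Hom.ext (LinearMap.add_comp _ _ _)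

section Projections

variable (X : GrMod 𝒜)

instance : DirectSum.Decomposition X.grading := X.isInternal.chooseDecomposition

/-- The projection of a graded module onto its component of degree `i`. -/
def proj (i : ℤ) : X.carrier →+ X.carrier :=
  (X.grading i).subtype.comp ((DFinsupp.evalAddMonoidHom i).comp
    (DirectSum.decomposeAddEquiv X.grading).toAddMonoidHom)

variable {X}

lemma proj_mem (i : ℤ) (x : X.carrier) : X.proj i x ∈ X.grading i :=
  ((DirectSum.decompose X.grading x) i).2

lemma proj_same {i : ℤ} {x : X.carrier} (hx : x ∈ X.grading i) : X.proj i x = x :=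
  DirectSum.decompose_of_mem_same _ hx

lemma proj_ne {i j : ℤ} (h : i ≠ j) {x : X.carrier} (hx : x ∈ X.grading i) : X.proj j x = 0 :=
  DirectSum.decompose_of_mem_ne _ hx h

open scoped Classical in
/-- The degrees in which an element of a graded module has a non-zero component. -/
def degrees (x : X.carrier) : Finset ℤ := (DirectSum.decompose X.grading x).support

lemma sum_proj (x : X.carrier) : ∑ i ∈ degrees x, X.proj i x = x := by
  classical
  unfold degrees
  convert DirectSum.sum_support_decompose X.grading x
  rfl

lemma proj_eq_zero {x : X.carrier} {i : ℤ} (hi : i ∉ degrees x) : X.proj i x = 0 := by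
  classical
  have : (DirectSum.decompose X.grading x) i = 0 := by
    by_contra h
    exact hi (DFinsupp.mem_support_iff.2 h)
  exact congrArg Subtype.val this

lemma sum_proj_of_subset {x : X.carrier} {s : Finset ℤ} (hs : degrees x ⊆ s) :
    ∑ i ∈ s, X.proj i x = x := by
  rw [← Finset.sum_subset hs fun i _ hi => proj_eq_zero hi, sum_proj]

lemma proj_map {X Y : GrMod 𝒜} (f : X ⟶ Y) (i : ℤ) (x : X.carrier) :
    Y.proj i (f.toLinearMap x) = f.toLinearMap (X.proj i x) := by
  conv_lhs => rw [← sum_proj_of_subset (Finset.subset_insert i (degrees x))]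
  rw [map_sum, map_sum, Finset.sum_eq_single i]
  · exact proj_same (f.map_mem (proj_mem i x))
  · exact fun j _ hj => proj_ne hj (f.map_mem (proj_mem j x))
  · simp

end Projections

section Pi

variable {ι : Type} [Fintype ι]

/-- The direct sum of a finite family of graded modules, realized as a product. -/
def pi (X : ι → GrMod 𝒜) : GrMod 𝒜 where
  carrier := ∀ s, (X s).carrier
  grading i := AddSubgroup.pi Set.univ fun s => (X s).grading i
  isInternal := by
    classical
    refine isInternal_of_projections _
      (fun i => AddMonoidHom.mk' (fun x s => (X s).proj i (x s)) fun x y => ?_)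
      (fun i x s _ => proj_mem i (x s)) (fun i x hx => ?_) (fun i j h x hx => ?_) (fun x => ?_)
    · ext s
      exact map_add _ _ _
    · ext s
      exact proj_same (hx s trivial)
    · ext s
      exact proj_ne h (hx s trivial)
    · refine ⟨Finset.univ.biUnion fun s => degrees (x s), ?_⟩
      ext s
      rw [Finset.sum_apply]
      exact sum_proj_of_subset (Finset.subset_biUnion_of_mem (fun s => degrees (x s))
        (Finset.mem_univ s))
  smul_mem ha hx s _ := (X s).smul_mem ha (hx s trivial)

end Pi

section Quotient

variable (X : GrMod 𝒜)

/-- The quotient of a graded module by a graded submodule. -/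
abbrev quotient (N : Submodule R X.carrier) (hN : ∀ i, ∀ x ∈ N, X.proj i x ∈ N) : GrMod 𝒜 where
  carrier := X.carrier ⧸ N
  grading i := (X.grading i).map N.mkQ.toAddMonoidHom
  isInternal := by
    refine isInternal_of_projections _ (fun i => QuotientAddGroup.map N.toAddSubgroup
      N.toAddSubgroup (X.proj i) (hN i)) ?_ ?_ ?_ ?_
    · intro i x
      obtain ⟨x, rfl⟩ := N.mkQ_surjective x
      exact ⟨_, proj_mem i x, rfl⟩
    · rintro i _ ⟨x, hx, rfl⟩
      exact congrArg N.mkQ (proj_same hx)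
    · rintro i j h _ ⟨x, hx, rfl⟩
      exact (congrArg N.mkQ (proj_ne h hx)).trans (map_zero _)
    · intro x
      obtain ⟨x, rfl⟩ := N.mkQ_surjective x
      refine ⟨degrees x, ?_⟩
      conv_rhs => rw [← sum_proj x, map_sum]
      rfl
  smul_mem := by
    rintro i j a _ ha ⟨x, hx, rfl⟩
    exact ⟨a • x, X.smul_mem ha hx, rfl⟩

end Quotient

end GrMod

end GradedModuleCategory

/-! ### Finitely presented graded modules -/

section GradedModulesPresentations

variable {R : Type w} [Ring R] {𝒜 : ℤ → AddSubgroup R}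

namespace FPGrMod

/-- A morphism of finitely presented graded modules from a linear map preserving degrees. -/
abbrev ofLinearMap {X Y : FPGrMod 𝒜} (f : X.obj.carrier →ₗ[R] Y.obj.carrier)
    (hf : ∀ {i : ℤ} {x : X.obj.carrier}, x ∈ X.obj.grading i → f x ∈ Y.obj.grading i) : X ⟶ Y :=
  ObjectProperty.homMk ⟨f, hf⟩

/-- The underlying linear map of a morphism of finitely presented graded modules. -/
abbrev lin {X Y : FPGrMod 𝒜} (f : X ⟶ Y) : X.obj.carrier →ₗ[R] Y.obj.carrier := f.hom.toLinearMap

lemma hom_ext {X Y : FPGrMod 𝒜} {f g : X ⟶ Y} (h : ∀ x, lin f x = lin g x) : f = g :=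
  ObjectProperty.hom_ext _ (GrMod.Hom.ext (LinearMap.ext h))

lemma lin_comp {X Y Z : FPGrMod 𝒜} (f : X ⟶ Y) (g : Y ⟶ Z) (x : X.obj.carrier) :
    lin (f ≫ g) x = lin g (lin f x) := rfl

lemma lin_add {X Y : FPGrMod 𝒜} (f g : X ⟶ Y) (x : X.obj.carrier) :
    lin (f + g) x = lin f x + lin g x := rfl

lemma lin_sum {X Y : FPGrMod 𝒜} {ι : Type*} (s : Finset ι) (f : ι → (X ⟶ Y)) (x : X.obj.carrier) :
    lin (∑ i ∈ s, f i) x = ∑ i ∈ s, lin (f i) x := by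
  classical
  induction s using Finset.induction_on with
  | empty => rfl
  | insert i s hi h => rw [Finset.sum_insert hi, Finset.sum_insert hi, lin_add, h]

instance : HasFiniteBiproducts (FPGrMod 𝒜) where
  out n := ⟨fun F => by
    have (s : Fin n) : Module.FinitePresentation R (F s).obj.carrier := (F s).property
    let P : FPGrMod 𝒜 := ⟨GrMod.pi fun s => (F s).obj,
      inferInstanceAs (Module.FinitePresentation R (∀ s, (F s).obj.carrier))⟩
    let b : Bicone F :=
      { pt := P
        π s := ofLinearMap (X := P) (LinearMap.proj s) fun h => h s trivial
        ι s := ofLinearMap (Y := P) (LinearMap.single R (fun s => (F s).obj.carrier) s)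
          fun {i x} h t _ => by
            by_cases hts : t = s
            · subst hts
              have e : (Pi.single t x : ∀ s, (F s).obj.carrier) t = x := Pi.single_eq_same _ _
              exact Set.mem_of_eq_of_mem e h
            · have e : (Pi.single s x : ∀ s, (F s).obj.carrier) t = 0 := Pi.single_eq_of_ne hts _
              exact Set.mem_of_eq_of_mem e (zero_mem ((F t).obj.grading i))
        ι_π s t := by
          by_cases h : s = t
          · subst h
            rw [dif_pos rfl]
            exact hom_ext fun x => Pi.single_eq_same (M := fun s => (F s).obj.carrier) s x
          · rw [dif_neg h]
            exact hom_ext fun x =>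
              Pi.single_eq_of_ne (M := fun s => (F s).obj.carrier) (Ne.symm h) x }
    refine ⟨⟨⟨b, isBilimitOfTotal b (hom_ext fun x => ?_)⟩⟩⟩
    rw [lin_sum]
    exact Finset.univ_sum_single (M := fun s => (F s).obj.carrier) x⟩

/-- A graded linear map which vanishes on the kernel of a surjective one descends. -/
lemma exists_desc {X Y Z : FPGrMod 𝒜} (p : X ⟶ Y) (hp : Function.Surjective (lin p)) (g : X ⟶ Z)
    (hg : LinearMap.ker (lin p) ≤ LinearMap.ker (lin g)) : ∃ d : Y ⟶ Z, p ≫ d = g := by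
  let d : Y.obj.carrier →ₗ[R] Z.obj.carrier :=
    ((LinearMap.ker (lin p)).liftQ (lin g) hg).comp
      ((lin p).quotKerEquivOfSurjective hp).symm.toLinearMap
  have hd (x : X.obj.carrier) : d (lin p x) = lin g x := by
    have : ((lin p).quotKerEquivOfSurjective hp).symm (lin p x) =
        (LinearMap.ker (lin p)).mkQ x := by
      rw [LinearEquiv.symm_apply_eq]
      rfl
    simp [d, this]
  refine ⟨ofLinearMap d fun {i y} hy => ?_, hom_ext hd⟩
  obtain ⟨x, rfl⟩ := hp y
  rw [← GrMod.proj_same hy, GrMod.proj_map, hd]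
  exact g.hom.map_mem (GrMod.proj_mem i x)

/-- A homogeneous submodule which is finitely generated has a finite set of homogeneous
generators. -/
lemma exists_homogeneous_generators (X : GrMod 𝒜) (N : Submodule R X.carrier)
    (hN : ∀ i, ∀ x ∈ N, X.proj i x ∈ N) (hN' : N.FG) :
    ∃ (n : ℕ) (d : Fin n → ℤ) (x : Fin n → X.carrier), (∀ j, x j ∈ X.grading (d j)) ∧
      Submodule.span R (Set.range x) = N := by
  classical
  obtain ⟨S, hS⟩ := hN'
  let T : Finset (ℤ × X.carrier) :=
    S.biUnion fun s => (GrMod.degrees s).image fun i => (i, X.proj i s)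
  let e := T.equivFin
  have hT (t : T) : t.1.2 ∈ X.grading t.1.1 ∧ t.1.2 ∈ N := by
    obtain ⟨t, ht⟩ := t
    obtain ⟨s, hs, ht⟩ := Finset.mem_biUnion.1 ht
    obtain ⟨i, hi, rfl⟩ := Finset.mem_image.1 ht
    exact ⟨GrMod.proj_mem i s, hN i s (hS ▸ Submodule.subset_span hs)⟩
  refine ⟨T.card, fun j => (e.symm j).1.1, fun j => (e.symm j).1.2, fun j => (hT _).1,
    le_antisymm (Submodule.span_le.2 ?_) ?_⟩
  · rintro _ ⟨j, rfl⟩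
    exact (hT _).2
  · rw [← hS, Submodule.span_le]
    intro s hs
    rw [SetLike.mem_coe, ← GrMod.sum_proj s]
    refine Submodule.sum_mem _ fun i hi => Submodule.subset_span ⟨e ⟨(i, X.proj i s), ?_⟩, ?_⟩
    · exact Finset.mem_biUnion.2 ⟨s, hs, Finset.mem_image_of_mem _ hi⟩
    · simp

end FPGrMod

end GradedModulesPresentations

/-! ### Graded modules as modules over homogeneous elements -/

section HomogeneousElements

variable {R : Type w} [Ring R]

/-- The category of homogeneous elements of a graded ring: the objects are the integers, the
morphisms from `d` to `e` are the elements of degree `e - d`, and the composition is the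
multiplication. -/
structure DegreeCat (𝒜 : ℤ → AddSubgroup R) where
  /-- the degree -/
  deg : ℤ

variable {𝒜 : ℤ → AddSubgroup R} [GradedRing 𝒜]

namespace DegreeCat

instance : Category (DegreeCat 𝒜) where
  Hom d e := 𝒜 (e.deg - d.deg)
  id d := ⟨1, by rw [sub_self]; exact SetLike.one_mem_graded 𝒜⟩
  comp {c d e} a b := ⟨a.1 * b.1, by
    rw [show e.deg - c.deg = (d.deg - c.deg) + (e.deg - d.deg) by ring]
    exact SetLike.mul_mem_graded a.2 b.2⟩
  id_comp a := Subtype.ext (one_mul _)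
  comp_id a := Subtype.ext (mul_one _)
  assoc a b c := Subtype.ext (mul_assoc _ _ _)

instance : Preadditive (DegreeCat 𝒜) where
  homGroup d e := inferInstanceAs (AddCommGroup (𝒜 (e.deg - d.deg)))
  add_comp _ _ _ _ _ _ := Subtype.ext (add_mul _ _ _)
  comp_add _ _ _ _ _ _ := Subtype.ext (mul_add _ _ _)

end DegreeCat

namespace FPGrMod

/-- The graded free module of rank one whose generator `1` has degree `-d`. -/
def free (d : ℤ) : FPGrMod 𝒜 where
  obj :=
    { carrier := R
      grading i := 𝒜 (i + d)
      isInternal := by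
        refine isInternal_of_projections _
          (fun i => AddMonoidHom.mk' (fun x => (GrMod.self 𝒜).proj (i + d) x) (map_add _))
          (fun i x => GrMod.proj_mem (X := GrMod.self 𝒜) _ _)
          (fun i x hx => GrMod.proj_same (X := GrMod.self 𝒜) hx)
          (fun i j h x hx => GrMod.proj_ne (X := GrMod.self 𝒜) (by simpa using h) hx)
          (fun x => ?_)
        refine ⟨(GrMod.degrees (X := GrMod.self 𝒜) x).map (Equiv.subRight d).toEmbedding, ?_⟩
        rw [Finset.sum_map]
        refine (Finset.sum_congr rfl fun i _ => ?_).trans (GrMod.sum_proj (X := GrMod.self 𝒜) x)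
        change (GrMod.self 𝒜).proj (i - d + d) x = _
        rw [sub_add_cancel]
      smul_mem {i j a x} ha hx := by
        rw [add_assoc]
        exact SetLike.mul_mem_graded ha hx }
  property := (inferInstance : Module.FinitePresentation R R)

/-- The morphism from a free graded module of rank one given by a homogeneous element. -/
def ofElement {X : FPGrMod 𝒜} {d : ℤ} (x : X.obj.carrier) (hx : x ∈ X.obj.grading (-d)) :
    free (𝒜 := 𝒜) d ⟶ X :=
  ofLinearMap (X := free d) (LinearMap.toSpanSingleton R _ x) fun {i a} ha => by
    have := X.obj.smul_mem (i := i + d) ha hx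
    rwa [add_neg_cancel_right] at this

/-- The generator of a free graded module of rank one. -/
def gen (d : ℤ) : (free (𝒜 := 𝒜) d).obj.carrier := (1 : R)

lemma gen_mem (d : ℤ) : gen d ∈ (free (𝒜 := 𝒜) d).obj.grading (-d) := by
  change (1 : R) ∈ 𝒜 (-d + d)
  rw [neg_add_cancel]
  exact SetLike.one_mem_graded 𝒜

/-- The carrier of `free d` is the ring itself, so the types of the scalar multiplication have to be
spelled out. -/
lemma smul_gen {d : ℤ} (a : (free (𝒜 := 𝒜) d).obj.carrier) :
    HSMul.hSMul (α := R) (β := (free (𝒜 := 𝒜) d).obj.carrier) a (gen d) = a :=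
  mul_one (M := R) a

lemma lin_eq_smul {X : FPGrMod 𝒜} {d : ℤ} (f : free (𝒜 := 𝒜) d ⟶ X)
    (a : (free (𝒜 := 𝒜) d).obj.carrier) :
    lin f a = HSMul.hSMul (α := R) (β := X.obj.carrier) a (lin f (gen d)) := by
  conv_lhs => rw [← smul_gen a]
  exact (lin f).map_smul (a : R) (gen d)

lemma free_hom_ext {X : FPGrMod 𝒜} {d : ℤ} {f g : free (𝒜 := 𝒜) d ⟶ X}
    (h : lin f (gen d) = lin g (gen d)) : f = g :=
  hom_ext fun a => by rw [lin_eq_smul f, lin_eq_smul g, h]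

lemma lin_ofElement_gen {X : FPGrMod 𝒜} {d : ℤ} (x : X.obj.carrier)
    (hx : x ∈ X.obj.grading (-d)) : lin (ofElement x hx) (gen d) = x :=
  one_smul R x

/-- Free graded modules of rank one are projective with respect to degree-preserving maps. -/
lemma exists_lift {X Y : FPGrMod 𝒜} (f : X ⟶ Y) {d : ℤ} (g : free (𝒜 := 𝒜) d ⟶ Y)
    (hg : lin g (gen d) ∈ LinearMap.range (lin f)) : ∃ l : free d ⟶ X, l ≫ f = g := by
  -- A preimage of a homogeneous element may be replaced by its component of the same degree.
  obtain ⟨x, hx⟩ := hg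
  refine ⟨ofElement (X.obj.proj (-d) x) (GrMod.proj_mem _ _), free_hom_ext ?_⟩
  rw [lin_comp, lin_ofElement_gen, ← GrMod.proj_map, hx,
    GrMod.proj_same (g.hom.map_mem (gen_mem d))]

variable (𝒜) in
/-- The identification of the homogeneous elements of a graded ring with the morphisms between
the free graded modules of rank one (right multiplications). -/
abbrev freeFunctor : DegreeCat 𝒜 ⥤ FPGrMod 𝒜 where
  obj d := free d.deg
  map {d e} a := ofElement (X := free e.deg) a.1 (by
    change a.1 ∈ 𝒜 (-d.deg + e.deg)
    rw [neg_add_eq_sub]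
    exact a.2)
  map_id d := free_hom_ext (lin_ofElement_gen _ _)
  map_comp {c d e} a b := free_hom_ext <| by
    rw [lin_comp]
    refine (lin_ofElement_gen (X := free e.deg) _ _).trans ?_
    refine Eq.trans ?_ (congrArg _ (lin_ofElement_gen (X := free d.deg) _ _).symm)
    rfl

lemma lin_freeFunctor_map_gen {d e : DegreeCat 𝒜} (a : d ⟶ e) :
    lin ((freeFunctor 𝒜).map a) (gen d.deg) = a.1 :=
  one_mul a.1

instance : (freeFunctor 𝒜).Additive where
  map_add {d e a b} := free_hom_ext <| by
    rw [lin_add]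
    refine (lin_freeFunctor_map_gen (a + b)).trans ?_
    exact congrArg₂ _ (lin_freeFunctor_map_gen a).symm (lin_freeFunctor_map_gen b).symm

instance : (freeFunctor 𝒜).Faithful where
  map_injective {d e a b} h := by
    have := congrArg (fun f => lin f (gen d.deg)) h
    exact Subtype.ext (((lin_freeFunctor_map_gen a).symm.trans this).trans
      (lin_freeFunctor_map_gen b))

instance : (freeFunctor 𝒜).Full where
  map_surjective {d e} f :=
    ⟨⟨lin f (gen d.deg), by
      have : lin f (gen d.deg) ∈ 𝒜 (-d.deg + e.deg) := f.hom.map_mem (gen_mem d.deg)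
      rwa [neg_add_eq_sub] at this⟩, free_hom_ext (lin_freeFunctor_map_gen _)⟩

variable (𝒜) in
/-- The fully faithful functor from the additive envelope of `DegreeCat 𝒜` to graded modules, whose
image consists of the free graded modules of finite rank. -/
abbrev matFunctor : Mat_ (DegreeCat 𝒜) ⥤ FPGrMod 𝒜 := matExtend (freeFunctor 𝒜)

lemma exists_lift_mat {X Y : FPGrMod 𝒜} (f : X ⟶ Y) {c : Mat_ (DegreeCat 𝒜)}
    (g : (matFunctor 𝒜).obj c ⟶ Y) (hg : ∀ x, lin g x ∈ LinearMap.range (lin f)) :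
    ∃ l : (matFunctor 𝒜).obj c ⟶ X, l ≫ f = g := by
  have h (j : c.ι) := exists_lift (d := (c.X j).deg) f
    (biproduct.ι (fun j => (freeFunctor 𝒜).obj (c.X j)) j ≫ g) (by rw [lin_comp]; exact hg _)
  choose l hl using h
  refine ⟨biproduct.desc l, biproduct.hom_ext' _ _ fun j => ?_⟩
  rw [biproduct.ι_desc_assoc, hl]

/-- Since free graded modules are projective, an exact sequence of graded modules which starts with
two free ones is a projective presentation. -/
lemma isPresentation_matFunctor {a b : Mat_ (DegreeCat 𝒜)} (f : a ⟶ b) {X : FPGrMod 𝒜}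
    (p : (matFunctor 𝒜).obj b ⟶ X) (hp : Function.Surjective (lin p))
    (hfp : LinearMap.range (lin ((matFunctor 𝒜).map f)) = LinearMap.ker (lin p)) :
    IsPresentation (matFunctor 𝒜) f p where
  w := hom_ext fun x => by
    have : lin ((matFunctor 𝒜).map f) x ∈ LinearMap.ker (lin p) := hfp ▸ ⟨x, rfl⟩
    exact this
  epi := ⟨fun g h e => hom_ext fun x => by
    obtain ⟨y, rfl⟩ := hp x
    exact congrArg (fun k => lin k y) e⟩
  desc g hg := exists_desc p hp g (by
    rw [← hfp]
    rintro _ ⟨x, rfl⟩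
    exact congrArg (fun k => lin k x) hg)
  lift g := by
    obtain ⟨l, hl⟩ := exists_lift_mat p g fun x => hp _
    obtain ⟨l, rfl⟩ := (matFunctor 𝒜).map_surjective l
    exact ⟨l, hl⟩
  exact g hg := by
    obtain ⟨l, hl⟩ := exists_lift_mat ((matFunctor 𝒜).map f) ((matFunctor 𝒜).map g) fun x => by
      rw [hfp]
      exact congrArg (fun k => lin k x) hg
    obtain ⟨l, rfl⟩ := (matFunctor 𝒜).map_surjective l
    exact ⟨l, (matFunctor 𝒜).map_injective (by rw [Functor.map_comp, hl])⟩

/-- Finitely generated homogeneous submodules are images of free graded modules. -/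
lemma exists_matFunctor_range_eq (X : FPGrMod 𝒜) (N : Submodule R X.obj.carrier)
    (hN : ∀ i, ∀ x ∈ N, X.obj.proj i x ∈ N) (hN' : N.FG) :
    ∃ (a : Mat_ (DegreeCat 𝒜)) (f : (matFunctor 𝒜).obj a ⟶ X), LinearMap.range (lin f) = N := by
  obtain ⟨n, d, x, hx, rfl⟩ := exists_homogeneous_generators X.obj N hN hN'
  -- The generator of `free d` has degree `-d`.
  let a : Mat_ (DegreeCat 𝒜) := { ι := Fin n, X := fun j => ⟨-d j⟩ }
  let t (j : Fin n) : (freeFunctor 𝒜).obj (a.X j) ⟶ X :=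
    ofElement (x j) (by simpa [a] using hx j)
  let f : (matFunctor 𝒜).obj a ⟶ X := biproduct.desc t
  have hf (j : Fin n) : biproduct.ι (fun j => (freeFunctor 𝒜).obj (a.X j)) j ≫ f = t j :=
    biproduct.ι_desc _ _
  refine ⟨a, f, le_antisymm ?_ (Submodule.span_le.2 ?_)⟩
  · rintro _ ⟨y, rfl⟩
    have h : f = ∑ j : Fin n, biproduct.π (fun j => (freeFunctor 𝒜).obj (a.X j)) j ≫ t j :=
      biproduct.desc_eq
    rw [h, lin_sum]
    refine Submodule.sum_mem _ fun j _ => ?_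
    rw [lin_comp, lin_eq_smul, lin_ofElement_gen]
    exact Submodule.smul_mem _ _ (Submodule.subset_span ⟨j, rfl⟩)
  · rintro _ ⟨j, rfl⟩
    refine ⟨lin (biproduct.ι (fun j => (freeFunctor 𝒜).obj (a.X j)) j) (gen (-d j)), ?_⟩
    rw [← lin_comp, hf]
    exact lin_ofElement_gen _ _

variable (𝒜) in
lemma isPresentedBy_matFunctor : IsPresentedBy (matFunctor 𝒜) where
  exists_cokernel {a b} f := by
    let N := LinearMap.range (lin ((matFunctor 𝒜).map f))
    have hN : ∀ i, ∀ x ∈ N, ((matFunctor 𝒜).obj b).obj.proj i x ∈ N := by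
      rintro i _ ⟨x, rfl⟩
      rw [GrMod.proj_map]
      exact ⟨_, rfl⟩
    have : Module.FinitePresentation R ((matFunctor 𝒜).obj a).obj.carrier :=
      ((matFunctor 𝒜).obj a).property
    have : Module.FinitePresentation R ((matFunctor 𝒜).obj b).obj.carrier :=
      ((matFunctor 𝒜).obj b).property
    let Q : FPGrMod 𝒜 := ⟨((matFunctor 𝒜).obj b).obj.quotient N hN,
      Module.finitePresentation_of_surjective N.mkQ N.mkQ_surjective (by
        rw [Submodule.ker_mkQ]
        exact Submodule.FG.of_finite)⟩
    exact ⟨Q, ofLinearMap (Y := Q) N.mkQ fun h => ⟨_, h, rfl⟩,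
      isPresentation_matFunctor f _ N.mkQ_surjective N.ker_mkQ.symm⟩
  exists_presentation X := by
    have : Module.FinitePresentation R X.obj.carrier := X.property
    obtain ⟨b, p, hp⟩ := exists_matFunctor_range_eq X ⊤ (fun _ _ _ => trivial) Module.Finite.fg_top
    have hp' : Function.Surjective (lin p) := LinearMap.range_eq_top.1 hp
    have : Module.FinitePresentation R ((matFunctor 𝒜).obj b).obj.carrier :=
      ((matFunctor 𝒜).obj b).property
    obtain ⟨a, f, hf⟩ := exists_matFunctor_range_eq ((matFunctor 𝒜).obj b) (LinearMap.ker (lin p))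
      (fun i x hx => by
        rw [LinearMap.mem_ker] at hx ⊢
        rw [← GrMod.proj_map, hx, map_zero])
      (Module.FinitePresentation.fg_ker _ hp')
    obtain ⟨f, rfl⟩ := (matFunctor 𝒜).map_surjective f
    exact ⟨a, b, f, p, isPresentation_matFunctor f p hp' hf⟩

/-- The graded ring itself is free of rank one. -/
def selfIso : FPGrMod.self 𝒜 ≅ free (𝒜 := 𝒜) 0 where
  hom := ofLinearMap (X := FPGrMod.self 𝒜) (Y := free 0) (LinearMap.id (R := R) (M := R))
    fun {i x} h => by
      change x ∈ 𝒜 (i + 0)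
      rwa [add_zero]
  inv := ofLinearMap (X := free 0) (Y := FPGrMod.self 𝒜) (LinearMap.id (R := R) (M := R))
    fun {i x} h => by
      change x ∈ 𝒜 (i + 0) at h
      rwa [add_zero] at h
  hom_inv_id := rfl
  inv_hom_id := rfl

/-- The graded ring is a direct summand of an object in the image of `matFunctor`. -/
def selfRetract :
    Retract (FPGrMod.self 𝒜) ((matFunctor 𝒜).obj { ι := PUnit, X := fun _ => ⟨0⟩ }) where
  i := selfIso.hom ≫ biproduct.ι (fun _ : PUnit => (freeFunctor 𝒜).obj ⟨0⟩) PUnit.unit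
  r := biproduct.π (fun _ : PUnit => (freeFunctor 𝒜).obj ⟨0⟩) PUnit.unit ≫ selfIso.inv
  retract := by
    rw [Category.assoc, biproduct.ι_π_self_assoc, Iso.hom_inv_id]

end FPGrMod

/-- If the homogeneous matrices over a graded ring have reflexive weak kernels, then the finitely
presented graded modules form an abelian category in which the ring has injective dimension at most
one. -/
lemma HasReflexiveWeakKernels.graded (h : HasReflexiveWeakKernels (Mat_ (DegreeCat 𝒜))) :
    ∃ _ : Abelian (FPGrMod 𝒜), HasInjectiveDimensionLE (FPGrMod.self 𝒜) 1 := by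
  have : HasZeroObject (Mat_ (DegreeCat 𝒜)) := hasZeroObject_of_hasFiniteBiproducts _
  have : HasBinaryBiproducts (Mat_ (DegreeCat 𝒜)) := hasBinaryBiproducts_of_finite_biproducts _
  let := (FPGrMod.isPresentedBy_matFunctor 𝒜).abelian h.weakKernelsExist
  have := (FPGrMod.isPresentedBy_matFunctor 𝒜).hasInjectiveDimensionLE_one h
    { ι := PUnit, X := fun _ => ⟨0⟩ }
  exact ⟨_, FPGrMod.selfRetract.hasInjectiveDimensionLT _⟩

end HomogeneousElements

/-! ### Weak kernels in a triangulated category -/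

section GradedHearts

open Pretriangulated Triangulated
open scoped ZeroObject

variable {T : Type*} [Category* T] [Preadditive T] [HasZeroObject T] [HasShift T ℤ]
  [∀ n : ℤ, (shiftFunctor T n).Additive] [Pretriangulated T]

/-- The diagram `X ⟶ Y ⟶ Z ⟶ X⟦1⟧` is a distinguished triangle. -/
def IsDistinguished {X Y Z : T} (f : X ⟶ Y) (g : Y ⟶ Z) (h : Z ⟶ X⟦(1 : ℤ)⟧) : Prop :=
  Triangle.mk f g h ∈ distTriang T

namespace IsDistinguished

section

variable {X Y Z : T} {f : X ⟶ Y} {g : Y ⟶ Z} {h : Z ⟶ X⟦(1 : ℤ)⟧}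

lemma comp_eq_zero₁₂ (H : IsDistinguished f g h) : f ≫ g = 0 :=
  comp_distTriang_mor_zero₁₂ _ H

lemma comp_eq_zero₂₃ (H : IsDistinguished f g h) : g ≫ h = 0 :=
  comp_distTriang_mor_zero₂₃ _ H

lemma rotate (H : IsDistinguished f g h) : IsDistinguished g h (-f⟦(1 : ℤ)⟧') :=
  rot_of_distTriang _ H

lemma exists_lift (H : IsDistinguished f g h) {A : T} (φ : A ⟶ Y) (hφ : φ ≫ g = 0) :
    ∃ ψ : A ⟶ X, ψ ≫ f = φ := by
  obtain ⟨ψ, hψ⟩ := Triangle.coyoneda_exact₂ _ H φ hφ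
  exact ⟨ψ, hψ.symm⟩

lemma exists_desc (H : IsDistinguished f g h) {A : T} (φ : Y ⟶ A) (hφ : f ≫ φ = 0) :
    ∃ ψ : Z ⟶ A, g ≫ ψ = φ := by
  obtain ⟨ψ, hψ⟩ := Triangle.yoneda_exact₂ _ H φ hφ
  exact ⟨ψ, hψ.symm⟩

lemma of_iso (H : IsDistinguished f g h) {X' Y' Z' : T} {f' : X' ⟶ Y'} {g' : Y' ⟶ Z'}
    {h' : Z' ⟶ X'⟦(1 : ℤ)⟧} (e₁ : X' ≅ X) (e₂ : Y' ≅ Y) (e₃ : Z' ≅ Z)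
    (h₁ : f' ≫ e₂.hom = e₁.hom ≫ f) (h₂ : g' ≫ e₃.hom = e₂.hom ≫ g)
    (h₃ : h' ≫ e₁.hom⟦1⟧' = e₃.hom ≫ h) : IsDistinguished f' g' h' :=
  isomorphic_distinguished _ H _ (Triangle.isoMk _ _ e₁ e₂ e₃ h₁ h₂ h₃)

lemma of_iso₁ (H : IsDistinguished f g h) {X' : T} (e : X' ≅ X) :
    IsDistinguished (e.hom ≫ f) g (h ≫ e.inv⟦(1 : ℤ)⟧') :=
  H.of_iso e (Iso.refl _) (Iso.refl _) (by simp) (by simp) (by simp [← Functor.map_comp])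

lemma of_iso₃ (H : IsDistinguished f g h) {Z' : T} (e : Z' ≅ Z) :
    IsDistinguished f (g ≫ e.inv) (e.hom ≫ h) :=
  H.of_iso (Iso.refl _) (Iso.refl _) e (by simp) (by simp) (by simp)

lemma nonempty_iso₃ (H : IsDistinguished f g h) {Z' : T} {g' : Y ⟶ Z'} {h' : Z' ⟶ X⟦(1 : ℤ)⟧}
    (H' : IsDistinguished f g' h') : Nonempty (Z ≅ Z') :=
  ⟨Triangle.π₃.mapIso (isoTriangleOfIso₁₂ _ _ H H' (Iso.refl _) (Iso.refl _)
    ((Category.comp_id f).trans (Category.id_comp f).symm))⟩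

/-- The inverse rotation of a distinguished triangle whose third object is a shift. -/
lemma exists_inv_rotate {u : Y ⟶ Z} {v : Z ⟶ X⟦(1 : ℤ)⟧} {w : X⟦(1 : ℤ)⟧ ⟶ Y⟦(1 : ℤ)⟧}
    (H : IsDistinguished u v w) : ∃ f : X ⟶ Y, w = -f⟦(1 : ℤ)⟧' ∧ IsDistinguished f u v := by
  obtain ⟨f, hf⟩ : ∃ f : X ⟶ Y, w = -f⟦(1 : ℤ)⟧' :=
    ⟨-(shiftFunctor T (1 : ℤ)).preimage w, by simp⟩
  refine ⟨f, hf, ?_⟩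
  rw [IsDistinguished, rotate_distinguished_triangle]
  rw [hf] at H
  exact H

lemma exists_cocone_map (H : IsDistinguished f g h) :
    ∃ (Q : T) (φ : Q⟦(1 : ℤ)⟧ ≅ Z) (q : Q ⟶ X), IsDistinguished q f (g ≫ φ.inv) := by
  obtain ⟨q, -, hq⟩ := (H.of_iso₃ (shiftNegShift Z (1 : ℤ))).exists_inv_rotate
  exact ⟨_, _, q, hq⟩

lemma exists_lift₃ (H : IsDistinguished f g h) {A : T} (φ : A ⟶ Z) (hφ : φ ≫ h = 0) :
    ∃ ψ : A ⟶ Y, ψ ≫ g = φ :=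
  H.rotate.exists_lift φ hφ

lemma exists_desc_shift (H : IsDistinguished f g h) {A : T} (φ : X ⟶ A)
    (hφ : h ≫ φ⟦(1 : ℤ)⟧' = 0) : ∃ ψ : Y ⟶ A, f ≫ ψ = φ := by
  obtain ⟨ψ, hψ⟩ := H.rotate.rotate.exists_desc (φ⟦(1 : ℤ)⟧') hφ
  obtain ⟨ψ, rfl⟩ := (shiftFunctor T (1 : ℤ)).map_surjective ψ
  exact ⟨-ψ, (shiftFunctor T (1 : ℤ)).map_injective (by simpa using hψ)⟩

/-- If the connecting morphism vanishes, the triangle splits. -/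
lemma nonempty_iso_biprod (H : IsDistinguished f g h) (hh : h = 0) :
    Nonempty (Y ≅ X ⊞ Z) :=
  ⟨(exists_iso_binaryBiproduct_of_distTriang _ H hh).choose⟩

end

lemma exists_cone {X Y : T} (f : X ⟶ Y) :
    ∃ (Z : T) (g : Y ⟶ Z) (h : Z ⟶ X⟦(1 : ℤ)⟧), IsDistinguished f g h :=
  distinguished_cocone_triangle f

lemma exists_cocone {Y Z : T} (g : Y ⟶ Z) :
    ∃ (X : T) (f : X ⟶ Y) (h : Z ⟶ X⟦(1 : ℤ)⟧), IsDistinguished f g h :=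
  distinguished_cocone_triangle₁ g

lemma inl_snd (X Y : T) : IsDistinguished (biprod.inl : X ⟶ X ⊞ Y) biprod.snd 0 :=
  binaryBiproductTriangle_distinguished X Y

lemma inr_fst (X Y : T) : IsDistinguished (biprod.inr : Y ⟶ X ⊞ Y) biprod.fst 0 :=
  (inl_snd Y X).of_iso (Iso.refl _) (biprod.braiding _ _) (Iso.refl _)
    (by ext <;> simp) (by simp) (by simp)

/-- The octahedron axiom. -/
lemma exists_octahedron [IsTriangulated T] {X₁ X₂ X₃ Z₁₂ Z₂₃ Z₁₃ : T} {u₁₂ : X₁ ⟶ X₂}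
    {v₁₂ : X₂ ⟶ Z₁₂} {w₁₂ : Z₁₂ ⟶ X₁⟦(1 : ℤ)⟧} (h₁₂ : IsDistinguished u₁₂ v₁₂ w₁₂)
    {u₂₃ : X₂ ⟶ X₃} {v₂₃ : X₃ ⟶ Z₂₃} {w₂₃ : Z₂₃ ⟶ X₂⟦(1 : ℤ)⟧}
    (h₂₃ : IsDistinguished u₂₃ v₂₃ w₂₃) {u₁₃ : X₁ ⟶ X₃} {v₁₃ : X₃ ⟶ Z₁₃}
    {w₁₃ : Z₁₃ ⟶ X₁⟦(1 : ℤ)⟧} (h₁₃ : IsDistinguished u₁₃ v₁₃ w₁₃) (comm : u₁₂ ≫ u₂₃ = u₁₃) :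
    ∃ (m₁ : Z₁₂ ⟶ Z₁₃) (m₃ : Z₁₃ ⟶ Z₂₃), v₁₂ ≫ m₁ = u₂₃ ≫ v₁₃ ∧
      IsDistinguished m₁ m₃ (w₂₃ ≫ v₁₂⟦(1 : ℤ)⟧') :=
  let o := someOctahedron comm h₁₂ h₂₃ h₁₃
  ⟨o.m₁, o.m₃, o.comm₁, o.mem⟩

end IsDistinguished

/-- The shifts of the objects of an abelian subcategory with enough injectives: `H a` consists of
the objects which are concentrated in cohomological degree `a`. The injectives `J` are required to
receive no morphisms from the other degrees, which amounts to the vanishing of the higher extensions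
with coefficients in `J`. -/
structure IsGradedHeart (H : ℤ → ObjectProperty T) : Prop where
  of_iso {a : ℤ} {X Y : T} : (X ≅ Y) → H a X → H a Y
  shift_iff {a : ℤ} {X : T} : H a (X⟦(1 : ℤ)⟧) ↔ H (a + 1) X
  hom_eq_zero {a b : ℤ} {X Y : T} (f : X ⟶ Y) : H a X → H b Y → a < b → f = 0
  ext {a : ℤ} {X Y Z : T} {f : X ⟶ Y} {g : Y ⟶ Z} {h : Z ⟶ X⟦(1 : ℤ)⟧} :
    IsDistinguished f g h → H a X → H a Z → H a Y
  exists_injective {a : ℤ} {X : T} : H a X → ∃ (J B : T) (j : X ⟶ J) (p : J ⟶ B)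
    (δ : B ⟶ X⟦(1 : ℤ)⟧), IsDistinguished j p δ ∧ H a J ∧ H a B ∧
      ∀ {b : ℤ} {C : T} (f : C ⟶ J), H b C → b ≠ a → f = 0

/-- The objects with a filtration whose subquotients are concentrated in the degrees
`a, ..., a + n`. -/
def IsHeartFiltered (H : ℤ → ObjectProperty T) : ℕ → ℤ → ObjectProperty T
  | 0, a, X => H a X
  | n + 1, a, X => ∃ (A Y : T) (i : A ⟶ X) (q : X ⟶ Y) (δ : Y ⟶ A⟦(1 : ℤ)⟧),
      IsDistinguished i q δ ∧ H a A ∧ IsHeartFiltered H n (a + 1) Y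

/-- The property `U` is closed under shifts, finite sums and isomorphisms, it contains the `H a`,
and every morphism from an object satisfying `U` which vanishes on all `H a` is zero. -/
structure IsGeneratedByHeart (H : ℤ → ObjectProperty T) (U : ObjectProperty T) : Prop where
  of_iso {X Y : T} : (X ≅ Y) → U X → U Y
  of_heart {a : ℤ} {X : T} : H a X → U X
  zero : U 0
  biprod {X Y : T} : U X → U Y → U (X ⊞ Y)
  shift_iff {X : T} : U (X⟦(1 : ℤ)⟧) ↔ U X
  hom_eq_zero {X Y : T} (f : X ⟶ Y) : U X →
    (∀ {a : ℤ} {C : T} (g : C ⟶ X), H a C → g ≫ f = 0) → f = 0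

namespace IsGradedHeart

variable {H : ℤ → ObjectProperty T}

lemma hom_eq_zero_of_isHeartFiltered (hH : IsGradedHeart H) {n : ℕ} {a b : ℤ} {C X : T} (f : C ⟶ X)
    (hC : H b C) (hX : IsHeartFiltered H n a X) (hab : b < a) : f = 0 := by
  induction n generalizing a X with
  | zero => exact hH.hom_eq_zero f hC hX hab
  | succ n ih =>
    obtain ⟨A, Y, i, q, δ, hT, hA, hY⟩ := hX
    obtain ⟨g, rfl⟩ := hT.exists_lift f (ih _ hY (by lia))
    rw [hH.hom_eq_zero g hC hA hab, zero_comp]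

/-- A morphism to `X⟦1⟧` vanishes on `C` if it does so after shifting. -/
lemma comp_shift_eq_zero (hH : IsGradedHeart H) {X Y : T} (f : X ⟶ Y) {a : ℤ}
    (hf : ∀ {C : T} (g : C ⟶ X), H (a + 1) C → g ≫ f = 0) {C : T} (hC : H a C)
    (g : C ⟶ X⟦(1 : ℤ)⟧) : g ≫ f⟦(1 : ℤ)⟧' = 0 := by
  let e : (C⟦(-1 : ℤ)⟧)⟦(1 : ℤ)⟧ ≅ C := shiftNegShift C (1 : ℤ)
  obtain ⟨g', hg'⟩ := (shiftFunctor T (1 : ℤ)).map_surjective (e.hom ≫ g)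
  rw [← cancel_epi e.hom, ← Category.assoc, ← hg', ← Functor.map_comp,
    hf g' (hH.shift_iff.1 (hH.of_iso e.symm hC)), Functor.map_zero, comp_zero]

/-- Extending a morphism to an injective in degree `a` meets no obstruction from degrees at least
`a`. -/
lemma hom_injective_eq_zero (hH : IsGradedHeart H) {n : ℕ} {a b : ℤ} {J X : T}
    (hJ : ∀ {b : ℤ} {C : T} (f : C ⟶ J), H b C → b ≠ a → f = 0)
    (hX : IsHeartFiltered H n b X) (f : X ⟶ J⟦(1 : ℤ)⟧) (hab : a ≤ b) : f = 0 := by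
  -- `J⟦1⟧` is injective in degree `a - 1`, so that `J⟦1⟧` receives no morphism from degree `b`.
  have hJ' {b : ℤ} {C : T} (f : C ⟶ J⟦(1 : ℤ)⟧) (hC : H b C) (hb : a ≤ b) : f = 0 := by
    have := hH.comp_shift_eq_zero (𝟙 J) (a := b)
      (fun g hC => by rw [hJ g hC (by lia), zero_comp]) hC f
    simpa using this
  induction n generalizing b X with
  | zero => exact hJ' f hX hab
  | succ n ih =>
    obtain ⟨A, Y, i, q, δ, hT, hA, hY⟩ := hX
    obtain ⟨g, rfl⟩ := hT.exists_desc f (hJ' _ hA hab)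
    rw [ih hY g (by lia), comp_zero]

variable [IsTriangulated T]

/-- The degrees of the fibre of a morphism from `V` to an object in degree `a` lie between `a + 1`
and the top degree of `V`, if the degrees of `V` are at least `a + 1`. -/
lemma isHeartFiltered_of_distinguished (hH : IsGradedHeart H) {n : ℕ} {a : ℤ} {W V B : T}
    {f : W ⟶ V} {g : V ⟶ B} {h : B ⟶ W⟦(1 : ℤ)⟧} (hT : IsDistinguished f g h) (hB : H a B)
    (hV : IsHeartFiltered H n (a + 1) V) : IsHeartFiltered H n (a + 1) W := by
  have key {W V B : T} {f : W ⟶ V} {g : V ⟶ B} {h : B ⟶ W⟦(1 : ℤ)⟧}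
      (hT : IsDistinguished f g h) (hB : H a B) (hV : H (a + 1) V) : H (a + 1) W :=
    hH.shift_iff.1 (hH.ext hT.rotate.rotate hB (hH.shift_iff.2 hV))
  cases n with
  | zero => exact key hT hB hV
  | succ n =>
    obtain ⟨C, V', i, q, δ, hT', hC, hV'⟩ := hV
    obtain ⟨E, e, e', hE⟩ := IsDistinguished.exists_cocone (i ≫ g)
    obtain ⟨m₁, m₃, -, hm⟩ := hT'.exists_octahedron hT.rotate hE.rotate rfl
    obtain ⟨y, -, hy⟩ := hm.exists_inv_rotate
    obtain ⟨x, -, hx⟩ := hy.exists_inv_rotate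
    exact ⟨E, V', x, y, _, hx, key hE hB hC, hV'⟩

/-- Every filtered object `X` admits a distinguished triangle `V ⟶ W ⟶ X ⟶ V⟦1⟧` with `V` and `W`
direct sums of objects concentrated in single degrees, such that `X ⟶ V⟦1⟧` vanishes on all objects
concentrated in a single degree. If `X` is a complex of injectives, `W` is the direct sum of its
cycles and `V` the direct sum of its boundaries.

The construction is by induction on the length of the filtration. Let `A` be the lowest piece of `X`
and embed it in an injective `J`, with quotient `B`. The embedding extends to `X ⟶ J`, whose cocone
`X'` is shorter than `X`. Then `X' ⊞ A` maps to `X` with cone `B`, and the resolution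
`V' ⟶ W' ⟶ X'` gives `V` and `W` up to splittings: `W` is `W' ⊞ A`, and `V⟦1⟧` is `V'⟦1⟧ ⊞ B`. -/
lemma exists_resolution (hH : IsGradedHeart H) {U : ObjectProperty T}
    (hU : IsGeneratedByHeart H U) {n : ℕ} {a : ℤ} {X : T} (hX : IsHeartFiltered H n a X) :
    ∃ (V W : T) (i : V ⟶ W) (p : W ⟶ X) (d : X ⟶ V⟦(1 : ℤ)⟧), U V ∧ U W ∧
      IsDistinguished i p d ∧ ∀ {b : ℤ} {C : T} (g : C ⟶ X), H b C → g ≫ d = 0 := by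
  induction n generalizing a X with
  | zero =>
    exact ⟨0, X, 0, 𝟙 X, 0, hU.zero, hU.of_heart hX, contractible_distinguished₁ X,
      fun g _ => comp_zero⟩
  | succ n ih =>
    obtain ⟨A, Y, i, q, δ, hT, hA, hY⟩ := hX
    obtain ⟨J, B, j, p, ε, hT', hJ, hB, hJ'⟩ := hH.exists_injective hA
    obtain ⟨x, hx⟩ : ∃ x : X ⟶ J, i ≫ x = j :=
      hT.exists_desc_shift j (hH.hom_injective_eq_zero hJ' hY _ (by lia))
    obtain ⟨X', k, e, hX'⟩ := IsDistinguished.exists_cocone x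
    have hX'f : IsHeartFiltered H n (a + 1) X' := by
      obtain ⟨m₁, m₃, -, hm⟩ := hT.exists_octahedron hX'.rotate hT' hx
      obtain ⟨f, -, hf⟩ := hm.exists_inv_rotate
      exact hH.isHeartFiltered_of_distinguished hf hB hY
    obtain ⟨V', W', i', p', d', hV', hW', hT'', hd'⟩ := ih hX'f
    -- The cone `Z` of `(k, i) : X' ⊞ A ⟶ X` is isomorphic to `B`.
    obtain ⟨Z, z, z', hZ⟩ := IsDistinguished.exists_cone (biprod.desc k i)
    have hZa : H a Z := by
      obtain ⟨m₁, m₃, hm₁, hm⟩ := (IsDistinguished.inl_snd X' A).exists_octahedron hZ hX'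
        (biprod.inl_desc k i)
      have hm₁' : m₁ = j := by
        rw [← hx, ← biprod.inr_desc_assoc k i x, ← hm₁, biprod.inr_snd_assoc]
      subst hm₁'
      obtain ⟨φ⟩ := hT'.nonempty_iso₃ hm
      exact hH.of_iso φ hB
    -- The cocone `W` of `X' ⊞ A ⟶ X' ⟶ V'⟦1⟧` is the direct sum of `A` and `W'`.
    obtain ⟨W, s, s', hW⟩ :=
      IsDistinguished.exists_cocone ((biprod.fst : X' ⊞ A ⟶ X') ≫ d')
    have hWU : U W := by
      obtain ⟨m₁, m₃, -, hm⟩ := (IsDistinguished.inr_fst X' A).rotate.exists_octahedron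
        hT''.rotate.rotate hW.rotate rfl
      obtain ⟨φ⟩ := hm.nonempty_iso_biprod (by rw [Functor.map_zero, comp_zero])
      exact hU.shift_iff.1 (hU.of_iso φ.symm
        (hU.biprod (hU.shift_iff.2 (hU.of_heart hA)) (hU.shift_iff.2 hW')))
    obtain ⟨V₁, d, d₂, hV₁⟩ := IsDistinguished.exists_cone (s ≫ biprod.desc k i)
    -- The connecting morphism from `Z` to the shift of `V'⟦1⟧` vanishes.
    have hzero : z' ≫ ((biprod.fst : X' ⊞ A ⟶ X') ≫ d')⟦(1 : ℤ)⟧' = 0 :=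
      hH.comp_shift_eq_zero _ (fun g hC => by rw [← Category.assoc, hd' _ hC]) hZa z'
    have hV₁U : U V₁ := by
      obtain ⟨m₁, m₃, -, hm⟩ := hW.exists_octahedron hZ hV₁ rfl
      obtain ⟨ψ⟩ := hm.nonempty_iso_biprod hzero
      exact hU.of_iso ψ.symm (hU.biprod (hU.shift_iff.2 hV') (hU.of_heart hZa))
    obtain ⟨V, φ, v, hv⟩ := hV₁.exists_cocone_map
    refine ⟨V, W, v, _, _, hU.shift_iff.1 (hU.of_iso φ.symm hV₁U), hWU, hv, fun {b C} g hC => ?_⟩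
    -- A morphism from an object concentrated in one degree lifts to `X' ⊞ A` and then to `W`.
    obtain ⟨t, rfl⟩ : ∃ t : C ⟶ X' ⊞ A, t ≫ biprod.desc k i = g := by
      by_cases hb : b = a
      · subst hb
        obtain ⟨t, ht⟩ := hT.exists_lift g (hH.hom_eq_zero_of_isHeartFiltered _ hC hY (by lia))
        exact ⟨t ≫ biprod.inr, by rw [Category.assoc, biprod.inr_desc, ht]⟩
      · obtain ⟨t, ht⟩ := hX'.exists_lift g (hJ' _ hC hb)
        exact ⟨t ≫ biprod.inl, by rw [Category.assoc, biprod.inl_desc, ht]⟩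
    obtain ⟨t, rfl⟩ := hW.exists_lift t (by rw [← Category.assoc, hd' _ hC])
    rw [Category.assoc, Category.assoc, ← Category.assoc s, hv.comp_eq_zero₂₃, comp_zero]

/-- If the cocones of the morphisms between objects satisfying `U` are filtered, then these
morphisms have reflexive weak kernels. This holds for every category `C` whose image consists of
objects satisfying `U` and has all of these as direct summands.

Let `X` be the cocone of `f` and `V ⟶ W ⟶ X` its resolution. Objects satisfying `U` are blind to
`X ⟶ V⟦1⟧`, so the composition `W ⟶ X ⟶ a` is a weak kernel of `f`. A morphism on `W` which kills
`V` factors through `X`, and if it kills also a lift to `W` of the connecting morphism `Q ⟶ X` from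
the desuspension `Q` of `b`, it factors through `a`: the weak kernel is a weak cokernel of
`V ⊞ Q ⟶ W`. -/
lemma hasReflexiveWeakKernels (hH : IsGradedHeart H) {U : ObjectProperty T}
    (hU : IsGeneratedByHeart H U)
    (hF : ∀ {X Y Z : T} {f : X ⟶ Y} {g : Y ⟶ Z} {h : Z ⟶ X⟦(1 : ℤ)⟧}, IsDistinguished f g h →
      U Y → U Z → ∃ (n : ℕ) (a : ℤ), IsHeartFiltered H n a X)
    {C : Type*} [Category* C] [Preadditive C] [HasBinaryBiproducts C] (Φ : C ⥤ T) [Φ.Full]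
    [Φ.Faithful] [Φ.Additive] (hΦ : ∀ c, U (Φ.obj c))
    (hΦ' : ∀ X, U X → ∃ c, Nonempty (Retract X (Φ.obj c))) : HasReflexiveWeakKernels C := by
  intro a b f
  obtain ⟨X, k, e, hX⟩ := IsDistinguished.exists_cocone (Φ.map f)
  obtain ⟨n, m, hXf⟩ := hF hX (hΦ a) (hΦ b)
  obtain ⟨V, W, i, p, d, hV, hW, hT, hd⟩ := hH.exists_resolution hU hXf
  have hp {Y : T} (hY : U Y) (g : Y ⟶ X) : ∃ l : Y ⟶ W, l ≫ p = g :=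
    hT.exists_lift₃ g (hU.hom_eq_zero _ hY fun g' hC => by
      rw [← Category.assoc, hd _ hC])
  -- The object `Q` is the desuspension of `Φ.obj b`, with its connecting morphism `q : Q ⟶ X`.
  obtain ⟨Q, φ, q, hq⟩ := hX.exists_cocone_map
  have hQ : U Q := hU.shift_iff.1 (hU.of_iso φ.symm (hΦ b))
  obtain ⟨q', hq'⟩ := hp hQ q
  obtain ⟨c, ⟨r⟩⟩ := hΦ' W hW
  obtain ⟨c₁, ⟨r₁⟩⟩ := hΦ' (V ⊞ Q) (hU.biprod hV hQ)
  have hqk : q' ≫ p ≫ k = 0 := by rw [← Category.assoc, hq', hq.comp_eq_zero₁₂]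
  have hip : i ≫ p = 0 := hT.comp_eq_zero₁₂
  -- Here `W` is only a direct summand of `Φ.obj c`: the additional component `1 - r.r ≫ r.i` cuts
  -- out the complement of `W`.
  refine ⟨c, c₁ ⊞ c, Φ.preimage (r.r ≫ p ≫ k),
    biprod.desc (Φ.preimage (r₁.r ≫ biprod.desc i q' ≫ r.i)) (𝟙 c - Φ.preimage (r.r ≫ r.i)),
    ?_, ?_, fun {x} t ht => ?_, fun {x} t ht => ?_⟩
  · apply Φ.map_injective
    simp [hX.comp_eq_zero₁₂]
  · apply biprod.hom_ext'
    · apply Φ.map_injective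
      have : biprod.desc i q' ≫ p ≫ k = 0 := by
        apply biprod.hom_ext'
        · simp [reassoc_of% hip]
        · simp [hqk]
      simp [this]
    · apply Φ.map_injective
      simp [Preadditive.sub_comp]
  · obtain ⟨s, hs⟩ := hX.exists_lift (Φ.map t) (by rw [← Φ.map_comp, ht, Φ.map_zero])
    obtain ⟨s', rfl⟩ := hp (hΦ x) s
    exact ⟨Φ.preimage (s' ≫ r.i), Φ.map_injective (by simpa using hs)⟩
  · have h₁ : biprod.desc i q' ≫ r.i ≫ Φ.map t = 0 := by
      have := congrArg (fun l => r₁.i ≫ Φ.map (biprod.inl ≫ l)) ht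
      simpa using this
    have h₂ : Φ.map t = r.r ≫ r.i ≫ Φ.map t := by
      have := congrArg (fun l => Φ.map (biprod.inr ≫ l)) ht
      simpa [Preadditive.sub_comp, sub_eq_zero] using this
    obtain ⟨ψ, hψ⟩ := hT.exists_desc (r.i ≫ Φ.map t) (by simpa using congrArg (biprod.inl ≫ ·) h₁)
    obtain ⟨χ, hχ⟩ := hq.exists_desc ψ (by
      rw [← hq', Category.assoc, hψ]
      simpa using congrArg (biprod.inr ≫ ·) h₁)
    exact ⟨Φ.preimage χ, Φ.map_injective (by rw [h₂, ← hψ, ← hχ]; simp)⟩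

end IsGradedHeart

end GradedHearts

/-! ### Additive closures -/

section AdditiveClosures

variable {C : Type*} [Category* C] [Preadditive C]

/-- The morphisms which are finite sums of morphisms factoring through an object satisfying `P`. -/
def sumsFactoringThrough (P : ObjectProperty C) (X Y : C) : AddSubmonoid (X ⟶ Y) :=
  AddSubmonoid.closure {f | ∃ (Z : C) (a : X ⟶ Z) (b : Z ⟶ Y), P Z ∧ f = a ≫ b}

lemma comp_mem_sumsFactoringThrough {P : ObjectProperty C} {X Y : C} {f : X ⟶ Y}
    (hf : f ∈ sumsFactoringThrough P X Y) {X' Y' : C} (a : X' ⟶ X) (b : Y ⟶ Y') :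
    a ≫ f ≫ b ∈ sumsFactoringThrough P X' Y' := by
  induction hf using AddSubmonoid.closure_induction with
  | mem f hf =>
    obtain ⟨Z, c, d, hZ, rfl⟩ := hf
    exact AddSubmonoid.subset_closure ⟨Z, a ≫ c, d ≫ b, hZ, by simp⟩
  | zero => rw [zero_comp, comp_zero]; exact zero_mem _
  | add f g _ _ hf hg => rw [Preadditive.add_comp, Preadditive.comp_add]; exact add_mem hf hg

/-- Objects of the additive closure are recognized by their identity morphism. -/
lemma addClosure_iff [HasFiniteBiproducts C] {P : ObjectProperty C} {X : C} :
    addClosure P X ↔ 𝟙 X ∈ sumsFactoringThrough P X X := by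
  constructor
  · rintro ⟨n, F, hF, ⟨r⟩⟩
    rw [← r.retract, ← Category.id_comp r.r, ← biproduct.total, Preadditive.sum_comp,
      Preadditive.comp_sum]
    exact sum_mem fun j _ => AddSubmonoid.subset_closure
      ⟨F j, r.i ≫ biproduct.π F j, biproduct.ι F j ≫ r.r, hF j, by simp⟩
  · intro h
    obtain ⟨l, hl, hl'⟩ := AddSubmonoid.exists_list_of_mem_closure h
    choose F a b hF hab using hl
    refine ⟨l.length, fun j => F l[j] (l.getElem_mem _), fun j => hF _ _,
      ⟨⟨biproduct.lift fun j => a l[j] (l.getElem_mem _),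
        biproduct.desc fun j => b l[j] (l.getElem_mem _), ?_⟩⟩⟩
    rw [biproduct.lift_desc, ← hl', ← Fin.sum_univ_getElem]
    exact Finset.sum_congr rfl fun j _ => (hab _ (l.getElem_mem _)).symm

lemma addClosure_of_retract [HasFiniteBiproducts C] {P : ObjectProperty C} {X Y : C}
    (r : Retract X Y) (h : addClosure P Y) : addClosure P X := by
  rw [addClosure_iff] at h ⊢
  have := comp_mem_sumsFactoringThrough h r.i r.r
  rwa [Category.id_comp, r.retract] at this

lemma subset_addClosure [HasFiniteBiproducts C] {P : ObjectProperty C} {X : C} (h : P X) :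
    addClosure P X :=
  addClosure_iff.2 (AddSubmonoid.subset_closure ⟨X, 𝟙 X, 𝟙 X, h, (Category.comp_id _).symm⟩)

lemma addClosure_mono [HasFiniteBiproducts C] {P Q : ObjectProperty C}
    (hPQ : ∀ X, P X → addClosure Q X) {X : C} (h : addClosure P X) : addClosure Q X := by
  rw [addClosure_iff] at h ⊢
  refine (AddSubmonoid.closure_le (S := sumsFactoringThrough Q X X)).2 ?_ h
  rintro _ ⟨Z, a, b, hZ, rfl⟩
  simpa using comp_mem_sumsFactoringThrough (addClosure_iff.1 (hPQ Z hZ)) a b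

lemma addClosure_map [HasFiniteBiproducts C] {D : Type*} [Category* D] [Preadditive D]
    [HasFiniteBiproducts D] (G : C ⥤ D) [G.Additive] {P : ObjectProperty C} {Q : ObjectProperty D}
    (hPQ : ∀ X, P X → Q (G.obj X)) {X : C} (h : addClosure P X) : addClosure Q (G.obj X) := by
  obtain ⟨n, F, hF, ⟨r⟩⟩ := h
  exact ⟨n, fun j => G.obj (F j), fun j => hPQ _ (hF j),
    ⟨(r.map G).trans (Retract.ofIso (G.mapBiproduct F))⟩⟩

lemma addClosure_op [HasFiniteBiproducts C] [HasFiniteBiproducts Cᵒᵖ] {P : ObjectProperty C}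
    {X : Cᵒᵖ} : addClosure P.op X ↔ addClosure P X.unop := by
  rw [addClosure_iff, addClosure_iff]
  constructor
  · intro h
    have : ∀ f ∈ sumsFactoringThrough P.op X X, f.unop ∈ sumsFactoringThrough P X.unop X.unop := by
      intro f hf
      induction hf using AddSubmonoid.closure_induction with
      | mem f hf =>
        obtain ⟨Z, a, b, hZ, rfl⟩ := hf
        exact AddSubmonoid.subset_closure ⟨Z.unop, b.unop, a.unop, hZ, rfl⟩
      | zero => exact zero_mem _
      | add f g _ _ hf hg => exact add_mem hf hg
    exact this _ h
  · intro h
    have : ∀ f ∈ sumsFactoringThrough P X.unop X.unop, f.op ∈ sumsFactoringThrough P.op X X := by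
      intro f hf
      induction hf using AddSubmonoid.closure_induction with
      | mem f hf =>
        obtain ⟨Z, a, b, hZ, rfl⟩ := hf
        exact AddSubmonoid.subset_closure ⟨Opposite.op Z, b.op, a.op, hZ, rfl⟩
      | zero => exact zero_mem _
      | add f g _ _ hf hg => exact add_mem hf hg
    exact this _ h

lemma addClosure_biprod [HasFiniteBiproducts C] {P : ObjectProperty C} {X Y : C}
    [HasBinaryBiproduct X Y] (hX : addClosure P X) (hY : addClosure P Y) :
    addClosure P (X ⊞ Y) := by
  rw [addClosure_iff] at *
  rw [← biprod.total]
  have h₁ := comp_mem_sumsFactoringThrough hX (biprod.fst : X ⊞ Y ⟶ X) (biprod.inl : X ⟶ X ⊞ Y)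
  have h₂ := comp_mem_sumsFactoringThrough hY (biprod.snd : X ⊞ Y ⟶ Y) (biprod.inr : Y ⟶ X ⊞ Y)
  rw [Category.id_comp] at h₁ h₂
  exact add_mem h₁ h₂

lemma addClosure_biproduct [HasFiniteBiproducts C] {P : ObjectProperty C} {ι : Type} [Finite ι]
    {F : ι → C} (hF : ∀ i, P (F i)) : addClosure P (⨁ F) := by
  have := Fintype.ofFinite ι
  rw [addClosure_iff, ← biproduct.total]
  exact sum_mem fun i _ => AddSubmonoid.subset_closure
    ⟨F i, biproduct.π F i, biproduct.ι F i, hF i, rfl⟩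

lemma hom_eq_zero_of_addClosure [HasFiniteBiproducts C] {P : ObjectProperty C} {X Y : C}
    (hX : addClosure P X) (f : X ⟶ Y) (hf : ∀ {Z : C} (g : Z ⟶ X), P Z → g ≫ f = 0) : f = 0 := by
  obtain ⟨n, F, hF, ⟨r⟩⟩ := hX
  have : r.r ≫ f = 0 := biproduct.hom_ext' _ _ fun j => by
    rw [← Category.assoc, hf _ (hF j), comp_zero]
  rw [← r.retract_assoc f, this, comp_zero]

end AdditiveClosures

/-! ### t-structures with enough injectives in the heart -/

section TStructures

open Pretriangulated Triangulated
open scoped ZeroObject Pretriangulated.Opposite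

variable {T : Type*} [Category* T] [Preadditive T] [HasZeroObject T] [HasShift T ℤ]
  [∀ n : ℤ, (shiftFunctor T n).Additive] [Pretriangulated T]

lemma IsDistinguished.exists_op {X Y Z : T} {f : X ⟶ Y} {g : Y ⟶ Z} {h : Z ⟶ X⟦(1 : ℤ)⟧}
    (H : IsDistinguished f g h) : ∃ h', IsDistinguished g.op f.op h' :=
  ⟨_, op_distinguished _ H⟩

/-- The opposite of a t-structure. -/
def opTStructure (t : TStructure T) : TStructure Tᵒᵖ where
  le n := (t.ge (-n)).op
  ge n := (t.le (-n)).op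
  le_shift n a n' h X hX := t.ge_shift (-n) (-a) (-n') (by lia) X.unop hX
  ge_shift n a n' h X hX := t.le_shift (-n) (-a) (-n') (by lia) X.unop hX
  zero' X Y f hX hY := by
    have : t.IsGE X.unop 0 := ⟨hX⟩
    have : t.IsLE Y.unop (-1) := ⟨hY⟩
    exact Quiver.Hom.unop_inj (t.zero f.unop (-1) 0)
  le_zero_le X hX := t.ge_antitone (by lia) _ hX
  ge_one_le X hX := t.le_monotone (by lia) _ hX
  exists_triangle_zero_one A := by
    obtain ⟨X, Y, hX, hY, f, g, h, H⟩ := t.exists_triangle A.unop (-1) 0 (by lia)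
    obtain ⟨h', H'⟩ := IsDistinguished.exists_op H
    exact ⟨Opposite.op Y, Opposite.op X, hY, hX, g.op, f.op, h', H'⟩

/-- The objects concentrated in degree `a`. -/
def heartAt (t : TStructure T) (a : ℤ) : ObjectProperty T := fun X => t.IsLE X a ∧ t.IsGE X a

lemma heartAt_op {t : TStructure T} {a : ℤ} {X : Tᵒᵖ} :
    heartAt (opTStructure t) a X ↔ heartAt t (-a) X.unop :=
  ⟨fun h => ⟨⟨h.2.1⟩, ⟨h.1.1⟩⟩, fun h => ⟨⟨h.2.1⟩, ⟨h.1.1⟩⟩⟩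

/-- The heart of `t` has enough injectives which moreover receive no morphisms from objects of the
heart placed in other degrees, as in `IsGradedHeart`. -/
def HasEnoughInjectivesInHeart (t : TStructure T) : Prop :=
  ∀ ⦃a : ℤ⦄ ⦃X : T⦄, heartAt t a X → ∃ (J B : T) (j : X ⟶ J) (p : J ⟶ B)
    (δ : B ⟶ X⟦(1 : ℤ)⟧), IsDistinguished j p δ ∧ heartAt t a J ∧ heartAt t a B ∧
      ∀ {b : ℤ} {C : T} (f : C ⟶ J), heartAt t b C → b ≠ a → f = 0

variable {t : TStructure T}

lemma isLE_of_isDistinguished {a : ℤ} {X Y Z : T} {f : X ⟶ Y} {g : Y ⟶ Z} {h : Z ⟶ X⟦(1 : ℤ)⟧}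
    (H : IsDistinguished f g h) [t.IsLE X a] [t.IsLE Z a] [IsTriangulated T] : t.IsLE Y a := by
  rw [t.isLE_iff_orthogonal a (a + 1) rfl]
  intro W φ hW
  obtain ⟨ψ, rfl⟩ := H.exists_desc φ (t.zero _ a (a + 1))
  rw [t.zero ψ a (a + 1), comp_zero]

lemma isGE_of_isDistinguished {a : ℤ} {X Y Z : T} {f : X ⟶ Y} {g : Y ⟶ Z} {h : Z ⟶ X⟦(1 : ℤ)⟧}
    (H : IsDistinguished f g h) [t.IsGE X a] [t.IsGE Z a] [IsTriangulated T] : t.IsGE Y a := by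
  rw [t.isGE_iff_orthogonal (a - 1) a (by lia)]
  intro W φ hW
  obtain ⟨ψ, rfl⟩ := H.exists_lift φ (t.zero _ (a - 1) a)
  rw [t.zero ψ (a - 1) a, zero_comp]

variable [HasFiniteBiproducts T]

/-- The finite direct sums of objects concentrated in single degrees, and their direct summands. -/
def heartSums (t : TStructure T) : ObjectProperty T :=
  addClosure fun X => ∃ a, heartAt t a X

/-- Both bounds are tested by orthogonality, which passes to direct sums and direct summands. -/
lemma bounded_of_heartSums {X : T} (hX : heartSums t X) : ∃ a b : ℤ, t.IsGE X a ∧ t.IsLE X b := by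
  obtain ⟨n, F, hF, ⟨r⟩⟩ := hX
  choose d hd using hF
  obtain ⟨M, hM⟩ := (Set.finite_range d).bddAbove
  obtain ⟨m, hm⟩ := (Set.finite_range d).bddBelow
  refine ⟨m, M, ?_, ?_⟩
  · rw [t.isGE_iff_orthogonal (m - 1) m (by lia)]
    intro Y f _
    have : f ≫ r.i = 0 := biproduct.hom_ext _ _ fun j => by
      have := (hd j).2
      have := hm ⟨j, rfl⟩
      rw [t.zero ((f ≫ r.i) ≫ biproduct.π F j) (m - 1) (d j) (by lia), zero_comp]
    rw [← Category.comp_id f, ← r.retract, reassoc_of% this, zero_comp]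
  · rw [t.isLE_iff_orthogonal M (M + 1) rfl]
    intro Y f _
    have : r.r ≫ f = 0 := biproduct.hom_ext' _ _ fun j => by
      have := (hd j).1
      have := hM ⟨j, rfl⟩
      rw [t.zero (biproduct.ι F j ≫ r.r ≫ f) (d j) (M + 1) (by lia), comp_zero]
    rw [← r.retract_assoc f, this, comp_zero]

variable [IsTriangulated T]

lemma isGradedHeart_heartAt (ht : HasEnoughInjectivesInHeart t) : IsGradedHeart (heartAt t) where
  of_iso e := fun ⟨_, _⟩ => ⟨t.isLE_of_iso e _, t.isGE_of_iso e _⟩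
  shift_iff {a X} := and_congr (t.isLE_shift_iff X (a + 1) 1 a) (t.isGE_shift_iff X (a + 1) 1 a)
  hom_eq_zero f := fun ⟨_, _⟩ ⟨_, _⟩ h => t.zero f _ _ h
  ext H := fun ⟨_, _⟩ ⟨_, _⟩ => ⟨isLE_of_isDistinguished H, isGE_of_isDistinguished H⟩
  exists_injective h := ht h

lemma isHeartFiltered_of_isGE_of_isLE {n : ℕ} {a : ℤ} {X : T} (h₁ : t.IsGE X a)
    (h₂ : t.IsLE X (a + n)) : IsHeartFiltered (heartAt t) n a X := by
  induction n generalizing a X with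
  | zero =>
    rw [Nat.cast_zero, add_zero] at h₂
    exact ⟨h₂, h₁⟩
  | succ n ih =>
    rw [show a + ((n + 1 : ℕ) : ℤ) = a + 1 + n by push_cast; ring] at h₂
    exact ⟨(t.truncLE a).obj X, (t.truncGT a).obj X, (t.truncLEι a).app X, (t.truncGTπ a).app X,
      (t.truncGTδLE a).app X, t.triangleLEGT_distinguished a X, ⟨inferInstance, inferInstance⟩,
      ih inferInstance inferInstance⟩

lemma isGeneratedByHeart_heartSums (ht : HasEnoughInjectivesInHeart t) :
    IsGeneratedByHeart (heartAt t) (heartSums t) where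
  of_iso e h := addClosure_of_retract (Retract.ofIso e.symm) h
  of_heart {a X} h := subset_addClosure ⟨a, h⟩
  zero := addClosure_iff.2 (by
    rw [(isZero_zero T).eq_of_src (𝟙 0) 0]
    exact zero_mem _)
  biprod := addClosure_biprod
  shift_iff {X} := by
    have hH := isGradedHeart_heartAt ht
    constructor
    · intro h
      refine addClosure_of_retract (Retract.ofIso (shiftShiftNeg X (1 : ℤ)).symm)
        (addClosure_map (shiftFunctor T (-1 : ℤ)) ?_ h)
      rintro Y ⟨a, hY⟩
      exact ⟨a + 1, hH.shift_iff.1 (hH.of_iso (shiftNegShift Y (1 : ℤ)).symm hY)⟩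
    · refine addClosure_map (shiftFunctor T (1 : ℤ)) ?_
      rintro Y ⟨a, hY⟩
      refine ⟨a - 1, hH.shift_iff.2 ?_⟩
      rwa [sub_add_cancel]
  hom_eq_zero f hX hf := hom_eq_zero_of_addClosure hX f fun g hZ => hf g hZ.choose_spec

/-- For a t-structure with enough injectives in its heart, every category with the same additive
closure as the graded heart has reflexive weak kernels. -/
lemma hasReflexiveWeakKernels_of_tStructure (ht : HasEnoughInjectivesInHeart t) {C : Type*}
    [Category* C] [Preadditive C] [HasBinaryBiproducts C] (Φ : C ⥤ T) [Φ.Full] [Φ.Faithful]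
    [Φ.Additive] (hΦ : ∀ c, heartSums t (Φ.obj c))
    (hΦ' : ∀ X, heartSums t X → ∃ c, Nonempty (Retract X (Φ.obj c))) :
    HasReflexiveWeakKernels C := by
  refine (isGradedHeart_heartAt ht).hasReflexiveWeakKernels (isGeneratedByHeart_heartSums ht) ?_ Φ
    hΦ hΦ'
  intro X Y Z f g h H hY hZ
  obtain ⟨a, b, hYa, hYb⟩ := bounded_of_heartSums hY
  obtain ⟨Q, φ, q, hq⟩ := H.exists_cocone_map
  have hU := isGeneratedByHeart_heartSums ht
  obtain ⟨c, d, hQc, hQd⟩ := bounded_of_heartSums (hU.shift_iff.1 (hU.of_iso φ.symm hZ))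
  let m := min a c
  let n := (max b d - m).toNat
  have := t.isGE_of_ge Q m c
  have := t.isGE_of_ge Y m a
  have := t.isLE_of_le Q d (m + n)
  have := t.isLE_of_le Y b (m + n)
  exact ⟨n, m, isHeartFiltered_of_isGE_of_isLE (isGE_of_isDistinguished hq)
    (isLE_of_isDistinguished hq)⟩

end TStructures

/-! ### Hearts of derived categories -/

section DerivedCategories

open Pretriangulated Triangulated DerivedCategory
open scoped ZeroObject Pretriangulated.Opposite

variable {A : Type u} [Category.{v} A] [Abelian A] [HasDerivedCategory.{w} A]

lemma heartAt_singleFunctor (X : A) (a : ℤ) :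
    heartAt TStructure.t a ((singleFunctor A a).obj X) :=
  ⟨inferInstance, inferInstance⟩

lemma exists_iso_of_heartAt {a : ℤ} {X : DerivedCategory A} (h : heartAt TStructure.t a X) :
    ∃ Y : A, Nonempty (X ≅ (singleFunctor A a).obj Y) :=
  have := h.1
  have := h.2
  exists_iso_singleFunctor_obj_of_isGE_of_isLE X a

lemma exists_isDistinguished_of_shortExact {X Y Z : A} {f : X ⟶ Y} {g : Y ⟶ Z} {w : f ≫ g = 0}
    (hS : (ShortComplex.mk f g w).ShortExact) (a : ℤ) :
    ∃ δ, IsDistinguished ((singleFunctor A a).map f) ((singleFunctor A a).map g) δ :=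
  ⟨_, triangleOfSES_distinguished
    (hS.map_of_exact (HomologicalComplex.single A (ComplexShape.up ℤ) a))⟩

/-- Injective objects have no higher extensions, and there are no extensions of negative degree. -/
lemma hasEnoughInjectivesInHeart [EnoughInjectives A] :
    HasEnoughInjectivesInHeart (TStructure.t : TStructure (DerivedCategory A)) := by
  intro a X hX
  obtain ⟨Y, ⟨e⟩⟩ := exists_iso_of_heartAt hX
  have hS : (ShortComplex.mk (Injective.ι Y) (cokernel.π (Injective.ι Y)) (by simp)).ShortExact :=
    { exact := ShortComplex.exact_cokernel _ }
  obtain ⟨δ, hδ⟩ := exists_isDistinguished_of_shortExact hS a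
  refine ⟨_, _, _, _, _, hδ.of_iso₁ e, heartAt_singleFunctor _ _, heartAt_singleFunctor _ _,
    fun {b C} f hC hb => ?_⟩
  obtain ⟨Z, ⟨e'⟩⟩ := exists_iso_of_heartAt hC
  rw [← cancel_epi e'.inv, comp_zero]
  obtain hb | hb := lt_or_gt_of_ne hb
  · exact TStructure.t.zero _ b a
  · exact to_singleFunctor_obj_eq_zero_of_injective
      (K := (CochainComplex.singleFunctor A b).obj Z) (e'.inv ≫ f) b hb

/-- The injectives of the opposite heart are the projectives of the heart. -/
lemma hasEnoughInjectivesInHeart_op [EnoughProjectives A] :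
    HasEnoughInjectivesInHeart
      (opTStructure (TStructure.t : TStructure (DerivedCategory A))) := by
  intro a X hX
  obtain ⟨Y, ⟨e⟩⟩ := exists_iso_of_heartAt (heartAt_op.1 hX)
  have hS : (ShortComplex.mk (kernel.ι (Projective.π Y)) (Projective.π Y) (by simp)).ShortExact :=
    { exact := ShortComplex.exact_kernel _ }
  obtain ⟨δ, hδ⟩ := exists_isDistinguished_of_shortExact hS (-a)
  obtain ⟨δ', hδ'⟩ := hδ.exists_op
  refine ⟨_, _, _, _, _, hδ'.of_iso₁ e.symm.op, heartAt_op.2 (heartAt_singleFunctor _ _),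
    heartAt_op.2 (heartAt_singleFunctor _ _), fun {b C} f hC hb => ?_⟩
  obtain ⟨Z, ⟨e'⟩⟩ := exists_iso_of_heartAt (heartAt_op.1 hC)
  apply Quiver.Hom.unop_inj
  rw [← cancel_mono e'.hom, unop_zero, zero_comp]
  obtain hb | hb := lt_or_gt_of_ne hb
  · exact TStructure.t.zero _ (-a) (-b)
  · exact from_singleFunctor_obj_eq_zero_of_projective
      (L := (CochainComplex.singleFunctor A (-b)).obj Z) (f.unop ≫ e'.hom) (-b) (by lia)

end DerivedCategories

/-! ### Enough injectives and projectives over a finite-dimensional algebra -/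

section EnoughInjectives

variable (k : Type v) (Λ : Type u) [Field k] [Ring Λ] [Algebra k Λ] [Module.Finite k Λ]

/-- The inclusion of the finitely generated modules into all modules. -/
def FDMod.forget : FDMod k Λ ⥤ ModuleCat.{u} Λ := (ModuleCat.isFG.{u} Λ).ι

instance : (FDMod.forget k Λ).Full := inferInstanceAs (ModuleCat.isFG.{u} Λ).ι.Full

instance : (FDMod.forget k Λ).Faithful := inferInstanceAs (ModuleCat.isFG.{u} Λ).ι.Faithful

instance : (FDMod.forget k Λ).PreservesMonomorphisms :=
  haveI : IsNoetherianRing Λ := IsNoetherianRing.of_finite k Λ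
  inferInstanceAs (forget₂ (FGModuleCat.{u} Λ) (ModuleCat.{u} Λ)).PreservesMonomorphisms

instance : (FDMod.forget k Λ).PreservesEpimorphisms :=
  haveI : IsNoetherianRing Λ := IsNoetherianRing.of_finite k Λ
  inferInstanceAs (forget₂ (FGModuleCat.{u} Λ) (ModuleCat.{u} Λ)).PreservesEpimorphisms

instance : EnoughProjectives (FDMod k Λ) where
  presentation X := by
    have : Module.Finite Λ X.obj := X.2
    obtain ⟨n, f, hf⟩ := Module.Finite.exists_fin' Λ X.obj
    let P : FDMod k Λ := FGModuleCat.of Λ (Fin n → Λ)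
    let π : P ⟶ X := InducedCategory.homMk (ModuleCat.ofHom f)
    have hπ : Epi ((FDMod.forget k Λ).map π) := (ModuleCat.epi_iff_surjective _).2 hf
    have hP : Projective ((FDMod.forget k Λ).obj P) :=
      ModuleCat.projective_of_free (Pi.basisFun Λ (Fin n))
    exact ⟨{
      p := P
      projective := (FDMod.forget k Λ).projective_of_map_projective hP
      f := π
      epi := (FDMod.forget k Λ).epi_of_epi_map hπ }⟩

lemma ModuleCat.injective_of_field (X : ModuleCat.{u} k) : Injective X where
  factors {Y Z} g f hf := by
    obtain ⟨s, hs⟩ := f.hom.exists_leftInverse_of_injective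
      (LinearMap.ker_eq_bot.2 ((ModuleCat.mono_iff_injective f).1 hf))
    refine ⟨ModuleCat.ofHom (g.hom ∘ₗ s), ?_⟩
    ext x
    exact congrArg g.hom (LinearMap.congr_fun hs x)

variable {k Λ} in
lemma ModuleCat.finite_restrictScalars (X : ModuleCat.{u} Λ) [Module.Finite Λ X] :
    Module.Finite k ((ModuleCat.restrictScalars (algebraMap k Λ)).obj X) := by
  let : Module k X := Module.compHom X (algebraMap k Λ)
  have : IsScalarTower k Λ X := ⟨fun a b x => by
    rw [Algebra.smul_def, mul_smul]
    rfl⟩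
  exact Module.Finite.trans (R := k) Λ X

/-- The coinduced module `Hom_k(Λ, X)` is injective, since `X` is injective as a `k`-module. -/
instance : EnoughInjectives (FDMod k Λ) where
  presentation X := by
    let f := algebraMap k Λ
    have : Module.Finite Λ X.obj := X.2
    have h₁ := ModuleCat.finite_restrictScalars (k := k) X.obj
    have h₂ := ModuleCat.finite_restrictScalars (k := k) (ModuleCat.of Λ Λ)
    let J₀ : ModuleCat.{u} Λ :=
      (ModuleCat.coextendScalars f).obj ((ModuleCat.restrictScalars f).obj X.obj)
    have hJ₀ : Module.Finite Λ J₀ := by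
      let H := (ModuleCat.restrictScalars f).obj (ModuleCat.of Λ Λ) →ₗ[k]
        (ModuleCat.restrictScalars f).obj X.obj
      let : Module k J₀ := (inferInstance : Module k H)
      have : Module.Finite k J₀ := (inferInstance : Module.Finite k H)
      have : IsScalarTower k Λ J₀ := ⟨fun a b g => by
        apply ModuleCat.CoextendScalars.ext
        apply LinearMap.ext
        intro (c : Λ)
        have hc : c * (a • b) = f a * (c * b) := by
          rw [mul_smul_comm, Algebra.smul_def]
        have hg : (show H from g) (c * (a • b) : Λ) = a • (show H from g) (c * b : Λ) := by
          rw [hc]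
          exact (show H from g).map_smul a (c * b : Λ)
        exact hg⟩
      exact Module.Finite.of_restrictScalars_finite k Λ J₀
    let J : FDMod k Λ := (⟨J₀, hJ₀⟩ : FGModuleCat Λ)
    have : Injective ((FDMod.forget k Λ).obj J) :=
      have := ModuleCat.injective_of_field k ((ModuleCat.restrictScalars f).obj X.obj)
      Injective.injective_of_adjoint (ModuleCat.restrictCoextendScalarsAdj.{u, v, u} f) _
    let ι₀ := (ModuleCat.restrictCoextendScalarsAdj.{u, v, u} f).unit.app X.obj
    let ι : X ⟶ J := InducedCategory.homMk ι₀
    have hι : Mono ((FDMod.forget k Λ).map ι) := inferInstanceAs (Mono ι₀)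
    exact ⟨{
      J := J
      injective := (FDMod.forget k Λ).injective_of_map_injective this
      f := ι
      mono := (FDMod.forget k Λ).mono_of_mono_map hι }⟩

end EnoughInjectives

/-! ### Yoneda categories -/

section YonedaCategories

open Triangulated DerivedCategory ZeroObject
open scoped Pretriangulated.Opposite

section

variable {A : Type u} [Category.{v} A] [Abelian A] [HasDerivedCategory.{w} A]

lemma heartSums_iff {X : DerivedCategory A} :
    heartSums TStructure.t X ↔ addClosure (fun X => ∃ (Y : A) (i : ℤ),
      X = ((singleFunctor A 0).obj Y)⟦i⟧) X := by
  constructor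
  · refine addClosure_mono ?_
    rintro Z ⟨a, hZ⟩
    obtain ⟨Y, ⟨e⟩⟩ := exists_iso_of_heartAt hZ
    exact addClosure_of_retract
      (Retract.ofIso (e ≪≫ (((singleFunctors A).shiftIso (-a) a 0 (by lia)).app Y).symm))
      (subset_addClosure ⟨Y, -a, rfl⟩)
  · refine addClosure_mono ?_
    rintro _ ⟨Y, i, rfl⟩
    exact subset_addClosure ⟨-i, TStructure.t.isLE_shift _ 0 i (-i),
      TStructure.t.isGE_shift _ 0 i (-i)⟩

lemma heartSums_op_iff {X : (DerivedCategory A)ᵒᵖ} :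
    heartSums (opTStructure TStructure.t) X ↔ heartSums TStructure.t X.unop := by
  refine Iff.trans ⟨addClosure_mono ?_, addClosure_mono ?_⟩
    (addClosure_op (P := fun X => ∃ a, heartAt TStructure.t a X))
  · rintro Z ⟨a, hZ⟩
    exact subset_addClosure ⟨-a, heartAt_op.1 hZ⟩
  · rintro Z ⟨a, hZ⟩
    refine subset_addClosure ⟨-a, heartAt_op.2 ?_⟩
    rwa [neg_neg]

end

/-- A full subcategory which is closed under binary biproducts has binary biproducts. -/
lemma hasBinaryBiproducts_fullSubcategory {C : Type*} [Category* C] [Preadditive C]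
    [HasBinaryBiproducts C] {P : ObjectProperty C} (hP : ∀ X Y, P X → P Y → P (X ⊞ Y)) :
    HasBinaryBiproducts P.FullSubcategory where
  has_binary_biproduct X Y := by
    let b : BinaryBicone X Y :=
      { pt := ⟨X.obj ⊞ Y.obj, hP _ _ X.2 Y.2⟩
        fst := P.homMk biprod.fst
        snd := P.homMk biprod.snd
        inl := P.homMk biprod.inl
        inr := P.homMk biprod.inr }
    exact HasBinaryBiproduct.mk ⟨b, isBinaryBilimitOfTotal b
      (ObjectProperty.hom_ext _ (biprod.total (X := X.obj) (Y := Y.obj)))⟩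

variable {k : Type v} {Λ : Type u} [Field k] [Ring Λ] [Algebra k Λ] [Module.Finite k Λ]
  [HasDerivedCategory.{w} (FDMod k Λ)]

lemma isYonedaObject_iff {X : DerivedCategory (FDMod k Λ)} :
    isYonedaObject k Λ X ↔ heartSums TStructure.t X :=
  heartSums_iff.symm

instance : HasBinaryBiproducts (YonedaCat k Λ) :=
  hasBinaryBiproducts_fullSubcategory fun _ _ hX hY => addClosure_biprod hX hY

instance : HasZeroObject (YonedaCat k Λ) where
  zero := by
    have : isYonedaObject k Λ 0 :=
      isYonedaObject_iff.2 (isGeneratedByHeart_heartSums hasEnoughInjectivesInHeart).zero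
    refine ⟨⟨0, this⟩, (IsZero.iff_id_eq_zero _).2 ?_⟩
    ext

lemma hasReflexiveWeakKernels_yonedaCat : HasReflexiveWeakKernels (YonedaCat k Λ) :=
  hasReflexiveWeakKernels_of_tStructure hasEnoughInjectivesInHeart (isYonedaObject k Λ).ι
    (fun c => isYonedaObject_iff.1 c.2)
    fun X hX => ⟨⟨X, isYonedaObject_iff.2 hX⟩, ⟨Retract.refl X⟩⟩

lemma hasReflexiveWeakKernels_yonedaCat_op : HasReflexiveWeakKernels (YonedaCat k Λ)ᵒᵖ :=
  hasReflexiveWeakKernels_of_tStructure hasEnoughInjectivesInHeart_op (isYonedaObject k Λ).ι.op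
    (fun c => heartSums_op_iff.2 (isYonedaObject_iff.1 c.unop.2))
    fun X hX => ⟨Opposite.op ⟨X.unop, isYonedaObject_iff.2 (heartSums_op_iff.1 hX)⟩,
      ⟨Retract.refl X⟩⟩

variable (k Λ) in
/-- The Yoneda category is the additive closure of the graded heart of the derived category, for the
standard t-structure as well as for its opposite. -/
theorem isGorensteinCat_yonedaCat : IsGorensteinCat (YonedaCat k Λ) 1 where
  isCoherent :=
    { hasWeakKernels := WeakKernelsExist.hasWeakKernels
        hasReflexiveWeakKernels_yonedaCat.weakKernelsExist
      hasWeakCokernels := WeakKernelsExist.hasWeakKernels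
        hasReflexiveWeakKernels_yonedaCat_op.weakKernelsExist }
  injDim_left := hasReflexiveWeakKernels_yonedaCat.reprInjDimLE
  injDim_right := hasReflexiveWeakKernels_yonedaCat_op.reprInjDimLE

end YonedaCategories

/-! ### Morphisms between shifts of an object -/

section ShiftedEndomorphisms

variable {D : Type*} [Category* D] [HasShift D ℤ]

/-- The morphism `N⟦c⟧ ⟶ N⟦d⟧` induced by a morphism `N ⟶ N⟦n⟧`, for `d = n + c`. Defining it as the
composition of `α` with the identity, seen as a morphism of degree `c` from `N⟦c⟧` to `N`, reduces
functoriality to the associativity of `ShiftedHom.comp`. -/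
def shiftedHomMap {N : D} {n c d : ℤ} (α : ShiftedHom N N n) (h : n + c = d) : N⟦c⟧ ⟶ N⟦d⟧ :=
  ShiftedHom.comp (𝟙 (N⟦c⟧) : ShiftedHom (N⟦c⟧) N c) α h

lemma shiftedHomMap_mk₀ {N : D} {n c : ℤ} (hn : n = 0) :
    shiftedHomMap (ShiftedHom.mk₀ n hn (𝟙 N)) (by rw [hn, zero_add]) = 𝟙 (N⟦c⟧) :=
  ShiftedHom.comp_mk₀_id _ n hn

lemma shiftedHomMap_comp {N : D} {m n p c d e : ℤ} (α : ShiftedHom N N m) (β : ShiftedHom N N n)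
    (h : n + m = p) (hm : m + c = d) (hn : n + d = e) :
    shiftedHomMap (α.comp β h) (by lia : p + c = e) = shiftedHomMap α hm ≫ shiftedHomMap β hn := by
  have h₁ : shiftedHomMap α hm ≫ shiftedHomMap β hn =
      ShiftedHom.comp (shiftedHomMap α hm : ShiftedHom (N⟦c⟧) N d) β hn := by
    simp [shiftedHomMap, ShiftedHom.comp]
  rw [h₁]
  exact (ShiftedHom.comp_assoc _ α β hm h (by lia)).symm

lemma shiftedHomMap_bijective {N : D} {n c d : ℤ} (h : n + c = d) :
    Function.Bijective fun α : ShiftedHom N N n => shiftedHomMap α h := by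
  have (α : ShiftedHom N N n) :
      shiftedHomMap α h = α⟦c⟧' ≫ (shiftFunctorAdd' D n c d h).inv.app N :=
    Category.id_comp _
  constructor
  · intro α β hαβ
    simp only [this, cancel_mono] at hαβ
    exact (shiftFunctor D c).map_injective hαβ
  · intro f
    obtain ⟨α, hα⟩ := (shiftFunctor D c).map_surjective
      (f ≫ (shiftFunctorAdd' D n c d h).hom.app N)
    exact ⟨α, by simp [this, hα]⟩

end ShiftedEndomorphisms

/-! ### The Yoneda algebra inside the derived category -/

section HomogeneousExtensions

open CategoryTheory.Abelian DerivedCategory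

variable {A : Type u} [Category.{v} A] [Abelian A] [HasExt.{w} A] [HasDerivedCategory.{w'} A]

/-- The morphism in the derived category given by an extension. -/
def extHom (M : A) {j : ℕ} {n : ℤ} (h : (j : ℤ) = n) :
    Ext M M j ≃+ ShiftedHom ((singleFunctor A 0).obj M) ((singleFunctor A 0).obj M) n :=
  Ext.homAddEquiv.trans (by subst h; exact AddEquiv.refl _)

lemma extHom_mk₀ (M : A) {n : ℤ} (h : ((0 : ℕ) : ℤ) = n) :
    extHom M h (Ext.mk₀ (𝟙 M)) = ShiftedHom.mk₀ n (by lia) (𝟙 _) := by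
  subst h
  exact (Ext.mk₀_hom (𝟙 M)).trans (by rw [CategoryTheory.Functor.map_id])

lemma extHom_comp (M : A) {i j l : ℕ} {m n p : ℤ} (x : Ext M M i) (y : Ext M M j) (h : i + j = l)
    (hi : (i : ℤ) = m) (hj : (j : ℤ) = n) (hp : n + m = p) :
    extHom M (by lia : (l : ℤ) = p) (x.comp y h) = (extHom M hi x).comp (extHom M hj y) hp := by
  subst hi hj h
  obtain rfl : ((i + j : ℕ) : ℤ) = p := by lia
  exact Ext.comp_hom x y rfl

/-- The morphism in the derived category given by the component of degree `n` of an element of the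
Yoneda algebra. -/
def yonedaHom (M : A) (n : ℤ) : YonedaAlgebra M →+
    ShiftedHom ((singleFunctor A 0).obj M) ((singleFunctor A 0).obj M) n :=
  DirectSum.toAddMonoid fun j =>
    if h : (j : ℤ) = n then (extHom M h).toAddMonoidHom else 0

lemma yonedaHom_of (M : A) {j : ℕ} {n : ℤ} (h : (j : ℤ) = n) (x : Ext M M j) :
    yonedaHom M n (DirectSum.of (YonedaExt M) j x) = extHom M h x := by
  rw [yonedaHom, DirectSum.toAddMonoid_of, dif_pos h]
  rfl

lemma yonedaHom_one (M : A) {n : ℤ} (hn : n = 0) :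
    yonedaHom M n 1 = ShiftedHom.mk₀ n hn (𝟙 _) :=
  (yonedaHom_of M (by lia) (Ext.mk₀ (𝟙 M))).trans (extHom_mk₀ M _)

lemma yonedaHom_mul (M : A) {m n p : ℤ} (h : n + m = p) {a b : YonedaAlgebra M}
    (ha : a ∈ yonedaGrading M m) (hb : b ∈ yonedaGrading M n) :
    yonedaHom M p (a * b) = (yonedaHom M m a).comp (yonedaHom M n b) h := by
  obtain rfl | ⟨i, x, hi, rfl⟩ := exists_of_mem_yonedaGrading ha
  · simp
  obtain rfl | ⟨j, y, hj, rfl⟩ := exists_of_mem_yonedaGrading hb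
  · simp
  rw [DirectSum.of_mul_of, yonedaHom_of M hi, yonedaHom_of M hj, ← extHom_comp M x y rfl]
  exact yonedaHom_of M _ _

lemma yonedaHom_bijective (M : A) (n : ℤ) :
    Function.Bijective fun a : yonedaGrading M n => yonedaHom M n a.1 := by
  constructor
  · refine (injective_iff_map_eq_zero
      ((yonedaHom M n).comp (yonedaGrading M n).subtype)).2 ?_
    rintro ⟨a, ha⟩ h
    obtain rfl | ⟨i, x, hi, rfl⟩ := exists_of_mem_yonedaGrading ha
    · rfl
    · have hx : extHom M hi x = 0 := (yonedaHom_of M hi x).symm.trans h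
      rw [EmbeddingLike.map_eq_zero_iff] at hx
      subst hx
      exact Subtype.ext (map_zero _)
  · intro α
    obtain hn | hn := lt_or_ge n 0
    · -- there are no morphisms of negative degree in the derived category
      refine ⟨0, ((map_zero _).trans ?_)⟩
      have := TStructure.t.isGE_shift ((singleFunctor A 0).obj M) 0 n (-n)
      exact (TStructure.t.zero α 0 (-n)).symm
    · obtain ⟨j, rfl⟩ := Int.eq_ofNat_of_zero_le hn
      obtain ⟨x, rfl⟩ := (extHom M rfl).surjective α
      exact ⟨⟨DirectSum.of (YonedaExt M) j x, of_mem_yonedaGrading M j x⟩, yonedaHom_of M rfl x⟩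

/-- The homogeneous elements of the Yoneda algebra of `M` are the morphisms between the shifts of
`M` in the derived category. -/
def yonedaFunctor (M : A) : DegreeCat (yonedaGrading M) ⥤ DerivedCategory A where
  obj d := ((singleFunctor A 0).obj M)⟦d.deg⟧
  map {d e} a := shiftedHomMap (yonedaHom M (e.deg - d.deg) a.1) (by lia)
  map_id d := by
    have : yonedaHom M (d.deg - d.deg) (𝟙 d : d ⟶ d).1 = _ := yonedaHom_one M (sub_self _)
    rw [this]
    exact shiftedHomMap_mk₀ _
  map_comp {c d e} a b := by
    have : yonedaHom M (e.deg - c.deg) (a ≫ b).1 = _ := yonedaHom_mul M (by lia) a.2 b.2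
    rw [this]
    exact shiftedHomMap_comp _ _ _ _ _

instance (M : A) : (yonedaFunctor M).Additive where
  map_add {d e a b} := by
    have : yonedaHom M (e.deg - d.deg) (a + b).1 = _ := map_add _ a.1 b.1
    simp only [yonedaFunctor, this, shiftedHomMap, ShiftedHom.comp_add]
    rfl

instance (M : A) : (yonedaFunctor M).Faithful where
  map_injective h := (yonedaHom_bijective M _).1 ((shiftedHomMap_bijective _).1 h)

instance (M : A) : (yonedaFunctor M).Full where
  map_surjective {d e} f := by
    obtain ⟨α, hα⟩ := (shiftedHomMap_bijective (by lia : e.deg - d.deg + d.deg = e.deg)).2 f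
    obtain ⟨a, rfl⟩ := (yonedaHom_bijective M _).2 α
    exact ⟨a, hα⟩

end HomogeneousExtensions

/-! ### Opposite graded rings -/

section OppositeDegrees

variable {R : Type w} [Ring R] (𝒜 : ℤ → AddSubgroup R) [GradedRing 𝒜]

/-- The homogeneous elements of the opposite ring form the opposite category. Degrees change sign,
as an element of degree `e - d` is a morphism from `d` to `e`, or one from `-e` to `-d`. -/
def opDegreeFunctor : DegreeCat (opGrading 𝒜) ⥤ (DegreeCat 𝒜)ᵒᵖ where
  obj d := Opposite.op ⟨-d.deg⟩
  map {d e} a := Quiver.Hom.op (X := (⟨-e.deg⟩ : DegreeCat 𝒜)) (Y := ⟨-d.deg⟩) ⟨a.1.unop, by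
    rw [show -d.deg - -e.deg = e.deg - d.deg by ring]
    exact a.2⟩
  map_id _ := rfl
  map_comp _ _ := rfl

instance : (opDegreeFunctor 𝒜).Additive where
  map_add := rfl

instance : (opDegreeFunctor 𝒜).Faithful where
  map_injective {d e a b} h := by
    have : a.1.unop = b.1.unop := congrArg (fun f => f.unop.1) h
    exact Subtype.ext (MulOpposite.unop_injective this)

instance : (opDegreeFunctor 𝒜).Full where
  map_surjective {d e} f := ⟨⟨MulOpposite.op f.unop.1, by
    have : f.unop.1 ∈ 𝒜 (-d.deg - -e.deg) := f.unop.2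
    rwa [show -d.deg - -e.deg = e.deg - d.deg by ring] at this⟩, rfl⟩

end OppositeDegrees

/-! ### The Yoneda algebra of an additive generator -/

section GradedGorenstein

open Triangulated DerivedCategory
open scoped Pretriangulated.Opposite

/-- If the graded heart has the same additive closure as the image of `G`, then the additive
envelope of the source of `G` has reflexive weak kernels. -/
lemma hasReflexiveWeakKernels_mat {T : Type*} [Category* T] [Preadditive T] [HasZeroObject T]
    [HasShift T ℤ] [∀ n : ℤ, (shiftFunctor T n).Additive] [Pretriangulated T] [IsTriangulated T]
    [HasFiniteBiproducts T] {t : TStructure T} (ht : HasEnoughInjectivesInHeart t)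
    {𝒢 : Type*} [Category* 𝒢] [Preadditive 𝒢] (G : 𝒢 ⥤ T) [G.Additive] [G.Full] [G.Faithful]
    (hG : ∀ X, heartSums t X ↔ addClosure (fun Z => ∃ g, Z = G.obj g) X) :
    HasReflexiveWeakKernels (Mat_ 𝒢) := by
  have : HasBinaryBiproducts (Mat_ 𝒢) := hasBinaryBiproducts_of_finite_biproducts _
  refine hasReflexiveWeakKernels_of_tStructure ht (matExtend G) (fun c => (hG _).2 ?_)
    (fun X hX => ?_)
  · exact addClosure_biproduct fun i => ⟨c.X i, rfl⟩
  · obtain ⟨n, F, hF, r⟩ := (hG X).1 hX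
    choose d hd using hF
    obtain rfl : F = fun j => G.obj (d j) := funext hd
    exact ⟨{ ι := Fin n, X := d }, r⟩

variable {k : Type v} {Λ : Type u} [Field k] [Ring Λ] [Algebra k Λ] [Module.Finite k Λ]

lemma heartSums_iff_of_isAdditiveGenerator [HasDerivedCategory.{w} (FDMod k Λ)] {M : FDMod k Λ}
    (hM : IsAdditiveGenerator M) {X : DerivedCategory (FDMod k Λ)} : heartSums TStructure.t X ↔
      addClosure (fun Z => ∃ d : ℤ, Z = ((singleFunctor (FDMod k Λ) 0).obj M)⟦d⟧) X := by
  rw [heartSums_iff]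
  refine ⟨addClosure_mono ?_, addClosure_mono ?_⟩
  · rintro _ ⟨Y, i, rfl⟩
    refine addClosure_map (singleFunctor (FDMod k Λ) 0 ⋙ shiftFunctor _ i) ?_ (hM Y)
    rintro _ rfl
    exact ⟨i, rfl⟩
  · rintro _ ⟨i, rfl⟩
    exact subset_addClosure ⟨M, i, rfl⟩

/-- Since `M` is an additive generator, its shifts have the same additive closure in the derived
category as the graded heart. The right modules are the left modules over the opposite ring, whose
homogeneous elements are the morphisms in the opposite derived category. -/
theorem isGradedGorenstein_yonedaAlgebra [HasExt.{w} (FDMod k Λ)] {M : FDMod k Λ}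
    (hM : IsAdditiveGenerator M) : IsGradedGorenstein (yonedaGrading M) 1 := by
  let := HasDerivedCategory.standard (FDMod k Λ)
  constructor
  · refine HasReflexiveWeakKernels.graded
      (hasReflexiveWeakKernels_mat hasEnoughInjectivesInHeart (yonedaFunctor M) fun X =>
        (heartSums_iff_of_isAdditiveGenerator hM).trans ⟨addClosure_mono ?_, addClosure_mono ?_⟩)
    · rintro _ ⟨d, rfl⟩
      exact subset_addClosure ⟨⟨d⟩, rfl⟩
    · rintro _ ⟨d, rfl⟩
      exact subset_addClosure ⟨d.deg, rfl⟩
  · refine HasReflexiveWeakKernels.graded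
      (hasReflexiveWeakKernels_mat hasEnoughInjectivesInHeart_op
        (opDegreeFunctor (yonedaGrading M) ⋙ (yonedaFunctor M).op) fun X =>
        heartSums_op_iff.trans ((heartSums_iff_of_isAdditiveGenerator hM).trans
          (addClosure_op.symm.trans ⟨addClosure_mono ?_, addClosure_mono ?_⟩)))
    · rintro Z ⟨d, hd⟩
      refine subset_addClosure ⟨⟨-d⟩, Opposite.unop_injective (hd.trans ?_)⟩
      change _ = ((singleFunctor (FDMod k Λ) 0).obj M)⟦- -d⟧
      rw [neg_neg]
    · rintro _ ⟨d, rfl⟩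
      exact subset_addClosure ⟨-d.deg, rfl⟩

end GradedGorenstein

end

theorem theorem4p4 (k : Type v) (Λ : Type u) [Field k] [Ring Λ] [Algebra k Λ]
    [Module.Finite k Λ] :
    (∀ [HasDerivedCategory.{w} (FDMod k Λ)], IsGorensteinCat (YonedaCat k Λ) 1) ∧
    (∀ [HasExt.{w'} (FDMod k Λ)] (M : FDMod k Λ), IsAdditiveGenerator M →
      IsGradedGorenstein (yonedaGrading M) 1) :=
  ⟨isGorensteinCat_yonedaCat k Λ, fun _ hM => isGradedGorenstein_yonedaAlgebra hM⟩
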